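/- Let $N\in\mathbb N$. Let $C(\bar O_N)$ be the universal $C^*$-algebra generated by the entries of an $N\times N$ matrix $\bar u=(\bar u_{ij})$, subject to the relations $\bar u_{ij}=\bar u_{ij}^*$, $\bar u\bar u^t=\bar u^t\bar u=1$, distinct entries on the same row or column anticommute, and entries on distinct rows and distinct columns commute. Let $\mathcal O(\bar O_N)\subset C(\bar O_N)$ be the $*$-subalgebra generated by the $\bar u_{ij}$, and let $\mathcal O(O_N)\subset C(O_N)$ be the algebra generated by the coordinates $u_{ij}(g)=g_{ij}$. Representations of $\bar O_N$ are matrices $w\in M_n(\mathcal O(\bar O_N))$ with $\Delta(w_{ij})=\sum_kw_{ik}\otimes w_{kj}$ and $\varepsilon(w_{ij})=\delta_{ij}$, where $\Delta,\varepsilon$ are the algebra morphisms with $\Delta(\bar u_{ij})=\sum_k\bar u_{ik}\otimes\bar u_{kj}$, $\varepsilon(\bar u_{ij})=\delta_{ij}$ (which exist). *Twisting.* Say that $x\in\mathcal O(O_N)$ has bidegree $(S,T)$, with $S,T\subset\{1,\ldots,N\}$, if $x(dge)=\prod_{i\in S}d_i\prod_{j\in T}e_j\,x(g)$ for all diagonal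 sign matrices $d,e$ and all $g\in O_N$, and put $\gamma(S,S')=(-1)^{\#\{(a,b)\in S\times S':a>b\}}$. There is a unique linear isomorphism $\theta:\mathcal O(O_N)\to\mathcal O(\bar O_N)$ such that $\theta(1)=1$, $\theta(u_{ij})=\bar u_{ij}$, and $\theta(x)\theta(y)=\gamma(S,S')\gamma(T,T')\theta(xy)$ for $x,y$ of bidegrees $(S,T),(S',T')$. A matrix $\rho\in M_n(\mathcal O(O_N))$ is a representation of $O_N$ if and only if $\theta(\rho)=(\theta(\rho_{ij}))$ is a representation of $\bar O_N$, and $\theta(\rho\otimes\tau)$ is equivalent to $\theta(\rho)\otimes\theta(\tau)$ for any two such representations $\rho,\tau$ of $O_N$. Thus $\rho\leftrightarrow\theta(\rho)$ is a one-to-one correspondence between the representations of $O_N$ and those of $\bar O_N$, preserving the fusion rules. *Magic representation.* Let $\mathbb Z_2^N=\langle g_1,\ldots,g_N\rangle$, let $\Phi:C^*(\mathbb Z_2^N)\to\mathcal O(\bar O_N)\otimes C^*(\mathbb Z_2^N)$ be the morphism of algebras $g_a\mapsto\sum_b\bar u_{ab}\otimes g_b$, and let $w\in M_{2^N}(\mathcal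 O(\bar O_N))$ be given by $\Psi(\delta_i)=\sum_kw_{ik}\otimes\delta_k$, where $\Psi:C(\mathbb Z_2^N)\to\mathcal O(\bar O_N)\otimes C(\mathbb Z_2^N)$ is obtained from $\Phi$ via the Fourier isomorphism $C(\mathbb Z_2^N)\simeq C^*(\mathbb Z_2^N)$, $\delta_i\mapsto2^{-N}\sum_j(-1)^{\langle i,j\rangle}g_1^{j_1}\cdots g_N^{j_N}$. *Antisymmetric representation.* For $0\le r\le N$ let $O_N$ act by $g^{\otimes r}$ on $X_r=\mathrm{span}(\xi_{i_1\ldots i_r}\mid i_1<\ldots<i_r)\subset(\mathbb C^N)^{\otimes r}$, where $\xi_{i_1\ldots i_r}=\sum_{\sigma\in S_r}\varepsilon(\sigma)e_{i_{\sigma(1)}}\otimes\ldots\otimes e_{i_{\sigma(r)}}$. **Theorem.** The matrix $w$ is a magic unitary (its entries are projections, summing up to $1$ on each row and column) and a representation of $\bar O_N$, and it corresponds to the full antisymmetric representation $\bigoplus_{r=0}^NX_r$ of $O_N$: in a suitable basis, the matrix coefficients of $\bigoplus_rX_r$ are mapped by $\theta$ to the entries of $w$. More precisely, with $g_A=\prod_{a\in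 A}g_a$: 1. For each $r$ the space $\mathrm{span}(g_A:|A|=r)$ is invariant under $\Phi$ (the coefficient of $g_B$ in $\Phi(g_A)$ is $0$ if $|A|\ne|B|$), and the representation $w^{(r)}$ of $\bar O_N$ on it corresponds to $X_r$ in the same sense. 2. With $S_N^A=\{\sigma\in S_N\mid\sigma_{|A^c}=\mathrm{id}\}$, the character of $w$ is $\sum_{r=0}^N\bar\chi_r$, where the character of $w^{(r)}$ is $\bar\chi_r=\sum_{|A|=r}\sum_{\sigma\in S_N^A}\prod_{a\in A}\bar u_{a\sigma(a)}$ (products in increasing order of $a$), the character of $X_r$ is $\chi_r=\sum_{|A|=r}\sum_{\sigma\in S_N^A}\varepsilon(\sigma)\prod_{a\in A}u_{a\sigma(a)}$, and $\theta(\chi_r)=\bar\chi_r$. In fact $\theta\big(\varepsilon(\sigma)\prod_{a\in A}u_{a\sigma(a)}\big)=\prod_{a\in A}\bar u_{a\sigma(a)}$ for any $A\subset\{1,\ldots,N\}$ and any $\sigma\in S_N^A$. -/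

import Mathlib

open scoped ENNReal TensorProduct DirectSum Kronecker

noncomputable section

namespace TwistedOrth

/-! ### The universal C*-algebra `C(Ō_N)` and its dense *-subalgebra -/

/-- The defining relations of `Ō_N` for a square matrix `v` over a *-ring: the entries are
self-adjoint, `v vᵗ = vᵗ v = 1`, distinct entries on the same row or on the same column
anticommute, and entries on distinct rows and distinct columns commute. -/
structure IsTwistedOrthogonal {N : ℕ} {B : Type*} [Ring B] [StarRing B]
    (v : Matrix (Fin N) (Fin N) B) : Prop where
  selfAdjoint : ∀ i j, star (v i j) = v i j
  row_orthogonal : ∀ i j, ∑ k, v i k * v j k = if i = j then 1 else 0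
  col_orthogonal : ∀ i j, ∑ k, v k i * v k j = if i = j then 1 else 0
  row_anticomm : ∀ i j l, j ≠ l → v i j * v i l = -(v i l * v i j)
  col_anticomm : ∀ i k j, i ≠ k → v i j * v k j = -(v k j * v i j)
  comm : ∀ i k j l, i ≠ k → j ≠ l → v i j * v k l = v k l * v i j

/-- A solution of the defining relations of `Ō_N` in some nonzero C*-algebra. -/
structure Solution (N : ℕ) : Type 1 where
  carrier : Type
  [cstar : CStarAlgebra carrier]
  [nontrivial : Nontrivial carrier]
  entry : Matrix (Fin N) (Fin N) carrier
  rel : IsTwistedOrthogonal entry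

instance (N : ℕ) (p : Solution N) : CStarAlgebra p.carrier := p.cstar

instance (N : ℕ) (p : Solution N) : Nontrivial p.carrier := p.nontrivial

/-- The entries of a solution of the relations in a C*-algebra have norm at most `1`. -/
theorem IsTwistedOrthogonal.norm_le_one {N : ℕ} {B : Type*} [CStarAlgebra B]
    {v : Matrix (Fin N) (Fin N) B} (h : IsTwistedOrthogonal v) (i j : Fin N) : ‖v i j‖ ≤ 1 := by
  let : PartialOrder B := CStarAlgebra.spectralOrder B
  let : StarOrderedRing B := CStarAlgebra.spectralOrderedRing B
  have h1 : star (v i j) * v i j ≤ 1 := by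
    have h2 := h.row_orthogonal i i
    rw [if_pos rfl] at h2
    rw [← h2, h.selfAdjoint]
    refine Finset.single_le_sum (f := fun k => v i k * v i k) (fun k _ => ?_) (Finset.mem_univ j)
    have := star_mul_self_nonneg (v i k)
    rwa [h.selfAdjoint] at this
  have h3 : ‖star (v i j) * v i j‖ ≤ 1 :=
    (CStarAlgebra.norm_le_one_iff_of_nonneg _ (star_mul_self_nonneg _)).2 h1
  rw [CStarRing.norm_star_mul_self] at h3
  nlinarith [norm_nonneg (v i j)]

/-- The C*-algebra of bounded families indexed by all solutions of the relations. -/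
abbrev Ambient (N : ℕ) : Type 1 := lp (fun p : Solution N => p.carrier) ∞

instance (N : ℕ) : CStarAlgebra (Ambient N) where

/-- The tautological matrix, whose component at a solution is that solution. -/
def ambientCoord (N : ℕ) (i j : Fin N) : Ambient N :=
  ⟨fun p => p.entry i j, memℓp_infty ⟨1, by
    rintro _ ⟨p, rfl⟩
    exact p.rel.norm_le_one i j⟩⟩

/-- `C(Ō_N)`, the universal C*-algebra given by the relations `IsTwistedOrthogonal`: the closed
*-algebra generated by the tautological matrix. -/
def cObar (N : ℕ) : StarSubalgebra ℂ (Ambient N) :=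
  (StarAlgebra.adjoin ℂ (Set.range fun p : Fin N × Fin N =>
    ambientCoord N p.1 p.2)).topologicalClosure

instance (N : ℕ) : IsClosed (cObar N : Set (Ambient N)) :=
  StarSubalgebra.isClosed_topologicalClosure _

/-- `C(Ō_N)` as a type. -/
def CObar (N : ℕ) : Type 1 := cObar N

instance (N : ℕ) : CStarAlgebra (CObar N) := inferInstanceAs (CStarAlgebra (cObar N))

/-- The standard coordinates `u_{ij} ∈ C(Ō_N)`. -/
def cCoord (N : ℕ) (i j : Fin N) : CObar N :=
  ⟨ambientCoord N i j, StarSubalgebra.le_topologicalClosure _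
    (StarAlgebra.subset_adjoin ℂ _ ⟨(i, j), rfl⟩)⟩

/-- The universal property of `C(Ō_N)`: for any solution of the relations in a C*-algebra there
is a *-morphism from `C(Ō_N)` which maps the standard coordinates to that solution. -/
def toSolution {N : ℕ} (p : Solution N) : CObar N →⋆ₐ[ℂ] p.carrier where
  toFun x := x.1 p
  map_one' := rfl
  map_mul' _ _ := rfl
  map_zero' := rfl
  map_add' _ _ := rfl
  commutes' _ := rfl
  map_star' _ := rfl

theorem toSolution_cCoord {N : ℕ} (p : Solution N) (i j : Fin N) :
    toSolution p (cCoord N i j) = p.entry i j := rfl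

theorem ext_toSolution {N : ℕ} {x y : CObar N}
    (h : ∀ p : Solution N, toSolution p x = toSolution p y) : x = y := by
  apply Subtype.ext
  apply lp.ext
  funext p
  exact h p

theorem isTwistedOrthogonal_cCoord (N : ℕ) :
    IsTwistedOrthogonal (Matrix.of (cCoord N)) where
  selfAdjoint i j := ext_toSolution fun p => by
    exact p.rel.selfAdjoint i j
  row_orthogonal i j := ext_toSolution fun p => by
    have h := p.rel.row_orthogonal i j
    split_ifs at h ⊢ <;> simpa [toSolution_cCoord] using h
  col_orthogonal i j := ext_toSolution fun p => by
    have h := p.rel.col_orthogonal i j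
    split_ifs at h ⊢ <;> simpa [toSolution_cCoord] using h
  row_anticomm i j l h := ext_toSolution fun p => by
    simpa [toSolution_cCoord] using p.rel.row_anticomm i j l h
  col_anticomm i k j h := ext_toSolution fun p => by
    simpa [toSolution_cCoord] using p.rel.col_anticomm i k j h
  comm i k j l h h' := ext_toSolution fun p => by
    simpa [toSolution_cCoord] using p.rel.comm i k j l h h'

/-- The *-algebra of representative functions on `Ō_N`: the dense *-subalgebra of `C(Ō_N)`
generated by the standard coordinates. -/
def polObar (N : ℕ) : StarSubalgebra ℂ (CObar N) :=
  StarAlgebra.adjoin ℂ (Set.range fun p : Fin N × Fin N => cCoord N p.1 p.2)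

/-- The algebra `polObar N` as a type. -/
abbrev PolObar (N : ℕ) : Type 1 := polObar N

/-- The standard coordinates `u_{ij}` of `Ō_N`. -/
def ubar (N : ℕ) : Matrix (Fin N) (Fin N) (PolObar N) := Matrix.of fun i j =>
  ⟨cCoord N i j, StarAlgebra.subset_adjoin ℂ _ ⟨(i, j), rfl⟩⟩

theorem isTwistedOrthogonal_ubar (N : ℕ) : IsTwistedOrthogonal (ubar N) where
  selfAdjoint i j := Subtype.ext ((isTwistedOrthogonal_cCoord N).selfAdjoint i j)
  row_orthogonal i j := by
    apply Subtype.ext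
    have h := (isTwistedOrthogonal_cCoord N).row_orthogonal i j
    rw [AddSubmonoidClass.coe_finsetSum]
    refine Eq.trans h ?_
    split_ifs <;> rfl
  col_orthogonal i j := by
    apply Subtype.ext
    have h := (isTwistedOrthogonal_cCoord N).col_orthogonal i j
    rw [AddSubmonoidClass.coe_finsetSum]
    refine Eq.trans h ?_
    split_ifs <;> rfl
  row_anticomm i j l h := Subtype.ext ((isTwistedOrthogonal_cCoord N).row_anticomm i j l h)
  col_anticomm i k j h := Subtype.ext ((isTwistedOrthogonal_cCoord N).col_anticomm i k j h)
  comm i k j l h h' := Subtype.ext ((isTwistedOrthogonal_cCoord N).comm i k j l h h')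

/-- `Δ` is the comultiplication of `Ō_N`: `Δ(u_{ij}) = ∑ₖ u_{ik} ⊗ u_{kj}`. -/
def IsComul {N : ℕ} (Δ : PolObar N →ₐ[ℂ] PolObar N ⊗[ℂ] PolObar N) : Prop :=
  ∀ i j, Δ (ubar N i j) = ∑ k, ubar N i k ⊗ₜ[ℂ] ubar N k j

/-- `ε` is the counit of `Ō_N`: `ε(u_{ij}) = δ_{ij}`. -/
def IsCounit {N : ℕ} (ε : PolObar N →ₐ[ℂ] ℂ) : Prop :=
  ∀ i j, ε (ubar N i j) = if i = j then 1 else 0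

/-- Finite dimensional representations of the quantum group `Ō_N`, in matrix form. -/
structure IsCorep {N : ℕ} (Δ : PolObar N →ₐ[ℂ] PolObar N ⊗[ℂ] PolObar N)
    (ε : PolObar N →ₐ[ℂ] ℂ) {n : Type*} [Fintype n] [DecidableEq n]
    (w : Matrix n n (PolObar N)) : Prop where
  comul : ∀ i j, Δ (w i j) = ∑ k, w i k ⊗ₜ[ℂ] w k j
  counit : ∀ i j, ε (w i j) = if i = j then 1 else 0

/-- Equivalence of matrix representations of `Ō_N`: conjugation by an invertible scalar
matrix. -/
def CorepEquiv {N : ℕ} {n : Type*} [Fintype n] [DecidableEq n]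
    (w w' : Matrix n n (PolObar N)) : Prop :=
  ∃ T : Matrix n n ℂ, IsUnit T ∧
    T.map (algebraMap ℂ (PolObar N)) * w = w' * T.map (algebraMap ℂ (PolObar N))

/-- Magic unitaries: the entries are projections, summing up to `1` on each row and column. -/
structure IsMagicUnitary {B : Type*} [Ring B] [StarRing B] {n : Type*} [Fintype n]
    (w : Matrix n n B) : Prop where
  selfAdjoint : ∀ i j, star (w i j) = w i j
  idempotent : ∀ i j, w i j * w i j = w i j
  row_sum : ∀ i, ∑ j, w i j = 1
  col_sum : ∀ j, ∑ i, w i j = 1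

/-! ### The action of `Ō_N` on the hypercube -/

/-- The group `ℤ₂^N`. -/
abbrev Cube (N : ℕ) : Type := Fin N → Multiplicative (ZMod 2)

/-- The element `∏_{a ∈ A} g_a` of `ℤ₂^N`, where `g_1, …, g_N` are the standard generators. -/
def cubeElt {N : ℕ} (A : Finset (Fin N)) : Cube N :=
  fun a => Multiplicative.ofAdd (if a ∈ A then 1 else 0)

/-- The element `∑_b u_{ab} ⊗ g_b`. -/
def coactGen (N : ℕ) (a : Fin N) : PolObar N ⊗[ℂ] MonoidAlgebra ℂ (Cube N) :=
  ∑ b, ubar N a b ⊗ₜ[ℂ] MonoidAlgebra.of ℂ (Cube N) (cubeElt {b})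

theorem cubeElt_mul_self {N : ℕ} (b : Fin N) : cubeElt {b} * cubeElt {b} = 1 := by
  funext a
  change Multiplicative.ofAdd ((if a ∈ ({b} : Finset (Fin N)) then (1 : ZMod 2) else 0) +
    (if a ∈ ({b} : Finset (Fin N)) then (1 : ZMod 2) else 0)) = 1
  split_ifs
  · rfl
  · rfl

theorem coactGen_mul (N : ℕ) (a c : Fin N) : coactGen N a * coactGen N c =
    ∑ b, ∑ d, (ubar N a b * ubar N c d) ⊗ₜ[ℂ]
      MonoidAlgebra.of ℂ (Cube N) (cubeElt {b} * cubeElt {d}) := by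
  simp only [coactGen, Finset.sum_mul, Finset.mul_sum, Algebra.TensorProduct.tmul_mul_tmul,
    map_mul]
  exact Finset.sum_comm

/-- Splitting of `coactGen_mul` into its diagonal and off-diagonal part. -/
theorem coactGen_mul' (N : ℕ) (a c : Fin N) : coactGen N a * coactGen N c =
    (if a = c then 1 else 0) + ∑ b, ∑ d, if b = d then 0 else (ubar N a b * ubar N c d) ⊗ₜ[ℂ]
      MonoidAlgebra.of ℂ (Cube N) (cubeElt {b} * cubeElt {d}) := by
  have h : ∀ b d, (ubar N a b * ubar N c d) ⊗ₜ[ℂ]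
      MonoidAlgebra.of ℂ (Cube N) (cubeElt {b} * cubeElt {d}) =
      (if b = d then (ubar N a b * ubar N c b) ⊗ₜ[ℂ] (1 : MonoidAlgebra ℂ (Cube N)) else 0) +
      (if b = d then 0 else (ubar N a b * ubar N c d) ⊗ₜ[ℂ]
        MonoidAlgebra.of ℂ (Cube N) (cubeElt {b} * cubeElt {d})) := by
    intro b d
    split_ifs with h
    · subst h
      rw [cubeElt_mul_self, map_one, add_zero]
    · rw [zero_add]
  rw [coactGen_mul]
  rw [Finset.sum_congr rfl fun b _ => Finset.sum_congr rfl fun d _ => h b d]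
  simp only [Finset.sum_add_distrib]
  congr 1
  simp only [Finset.sum_ite_eq, Finset.mem_univ, if_true]
  rw [← TensorProduct.sum_tmul, (isTwistedOrthogonal_ubar N).row_orthogonal]
  split_ifs
  · rfl
  · exact TensorProduct.zero_tmul _ _

theorem coactGen_mul_self (N : ℕ) (a : Fin N) : coactGen N a * coactGen N a = 1 := by
  rw [coactGen_mul', if_pos rfl, add_eq_left]
  set f : Fin N → Fin N → PolObar N ⊗[ℂ] MonoidAlgebra ℂ (Cube N) := fun b d =>
    if b = d then 0 else (ubar N a b * ubar N a d) ⊗ₜ[ℂ]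
      MonoidAlgebra.of ℂ (Cube N) (cubeElt {b} * cubeElt {d}) with hf
  have hneg : ∀ b d, f b d = -f d b := by
    intro b d
    simp only [hf]
    by_cases h : b = d
    · simp [h]
    · rw [if_neg h, if_neg (Ne.symm h), (isTwistedOrthogonal_ubar N).row_anticomm a b d h,
        mul_comm (cubeElt {b})]
      exact TensorProduct.neg_tmul _ _
  have h1 : ∑ b, ∑ d, f b d = -∑ b, ∑ d, f b d := by
    conv_lhs => rw [Finset.sum_comm]
    simp only [← Finset.sum_neg_distrib]
    exact Finset.sum_congr rfl fun b _ => Finset.sum_congr rfl fun d _ => hneg d b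
  have h2 : (2 : ℂ) • ∑ b, ∑ d, f b d = 0 := by
    rw [two_smul]
    nth_rewrite 2 [h1]
    exact add_neg_cancel _
  have h3 := congrArg (fun x => (2 : ℂ)⁻¹ • x) h2
  simp only [smul_zero] at h3
  rwa [smul_smul, inv_mul_cancel₀ two_ne_zero, one_smul] at h3

theorem coactGen_commute (N : ℕ) (a c : Fin N) : Commute (coactGen N a) (coactGen N c) := by
  by_cases hac : a = c
  · rw [hac]
  · rw [commute_iff_eq, coactGen_mul', coactGen_mul', if_neg hac, if_neg (Ne.symm hac)]
    congr 1
    rw [Finset.sum_comm]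
    refine Finset.sum_congr rfl fun b _ => Finset.sum_congr rfl fun d _ => ?_
    by_cases h : b = d
    · simp [h]
    · rw [if_neg h, if_neg (Ne.symm h),
        (isTwistedOrthogonal_ubar N).comm a c d b hac (Ne.symm h), mul_comm (cubeElt {b})]

/-- The morphism `ℤ₂ → (PolObar N ⊗ ℂ[ℤ₂^N])` which sends the generator to `∑_b u_{ab} ⊗ g_b`. -/
def coactHom (N : ℕ) (a : Fin N) :
    Multiplicative (ZMod 2) →* PolObar N ⊗[ℂ] MonoidAlgebra ℂ (Cube N) where
  toFun x := coactGen N a ^ (Multiplicative.toAdd x).val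
  map_one' := rfl
  map_mul' x y := by
    rw [← pow_add, toAdd_mul, ZMod.val_add]
    have h2 : coactGen N a ^ 2 = 1 := by rw [pow_two, coactGen_mul_self]
    exact (pow_eq_pow_mod _ h2).symm

theorem coactHom_commute (N : ℕ) :
    Pairwise fun a c => ∀ x y, Commute (coactHom N a x) (coactHom N c y) :=
  fun a c _ _ _ => (coactGen_commute N a c).pow_pow _ _

/-- The coaction `Φ : C*(ℤ₂^N) → C(Ō_N) ⊗ C*(ℤ₂^N)`, the morphism of algebras given by
`g_a ↦ ∑_b u_{ab} ⊗ g_b`. -/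
def coaction (N : ℕ) :
    MonoidAlgebra ℂ (Cube N) →ₐ[ℂ] PolObar N ⊗[ℂ] MonoidAlgebra ℂ (Cube N) :=
  MonoidAlgebra.lift ℂ _ (Cube N)
    (MonoidHom.noncommPiCoprod (coactHom N) (coactHom_commute N))

theorem coaction_gen (N : ℕ) (a : Fin N) :
    coaction N (MonoidAlgebra.of ℂ (Cube N) (cubeElt {a})) =
      ∑ b, ubar N a b ⊗ₜ[ℂ] MonoidAlgebra.of ℂ (Cube N) (cubeElt {b}) := by
  have h : (cubeElt {a} : Cube N) = Pi.mulSingle a (Multiplicative.ofAdd 1) := by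
    funext c
    by_cases hc : c = a
    · subst hc; simp [cubeElt]
    · simp [cubeElt, hc]
  rw [coaction, MonoidAlgebra.lift_of, h, MonoidHom.noncommPiCoprod_mulSingle]
  exact pow_one _

/-- The sign `(-1)^{⟨i,j⟩}`, for `i, j ∈ ℤ₂^N`. -/
def pairing {N : ℕ} (i j : Cube N) : ℂ :=
  (-1) ^ ∑ k, (Multiplicative.toAdd (i k)).val * (Multiplicative.toAdd (j k)).val

/-- The Fourier transform `α : C(ℤ₂^N) → C*(ℤ₂^N)`,
`δ_i ↦ 2^{-N} ∑_j (-1)^{⟨i,j⟩} g^j`. -/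
def fourier (N : ℕ) : (Cube N → ℂ) →ₗ[ℂ] MonoidAlgebra ℂ (Cube N) where
  toFun f := ∑ i, ∑ j, (f i * ((2 : ℂ) ^ N)⁻¹ * pairing i j) • MonoidAlgebra.of ℂ (Cube N) j
  map_add' f f' := by simp only [Pi.add_apply, add_mul, add_smul, Finset.sum_add_distrib]
  map_smul' c f := by
    simp only [Pi.smul_apply, smul_eq_mul, mul_assoc, mul_smul, Finset.smul_sum, RingHom.id_apply]

/-- The inverse Fourier transform `β : C*(ℤ₂^N) → C(ℤ₂^N)`, `g^i ↦ ∑_j (-1)^{⟨i,j⟩} δ_j`. -/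
def fourierInv (N : ℕ) : MonoidAlgebra ℂ (Cube N) →ₗ[ℂ] (Cube N → ℂ) where
  toFun x := fun j => ∑ i, x.coeff i * pairing i j
  map_add' x y := by
    funext j
    simp [add_mul, Finset.sum_add_distrib]
  map_smul' c x := by
    funext j
    simp [mul_assoc, Finset.mul_sum]

/-- The action `Ψ = (id ⊗ β) Φ α : C(ℤ₂^N) → C(Ō_N) ⊗ C(ℤ₂^N)` on the hypercube. -/
def cubeAction (N : ℕ) : (Cube N → ℂ) →ₗ[ℂ] PolObar N ⊗[ℂ] (Cube N → ℂ) :=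
  (fourierInv N).lTensor (PolObar N) ∘ₗ (coaction N).toLinearMap ∘ₗ fourier N

/-- The magic representation of `Ō_N` on the `2^N` vertices of the hypercube: the matrix
`w` given by `Ψ(δ_i) = ∑_k w_{ik} ⊗ δ_k`. -/
def magic (N : ℕ) : Matrix (Cube N) (Cube N) (PolObar N) := Matrix.of fun i k =>
  TensorProduct.rid ℂ (PolObar N)
    ((LinearMap.proj k : (Cube N → ℂ) →ₗ[ℂ] ℂ).lTensor (PolObar N)
      (cubeAction N (Pi.single i 1)))

/-- The coefficient of `g_B` in `Φ(g_A)`, where `g_A = ∏_{a ∈ A} g_a`. -/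
def coactCoeff {N : ℕ} (A B : Finset (Fin N)) : PolObar N :=
  TensorProduct.rid ℂ (PolObar N)
    (((Finsupp.lapply (cubeElt B) : (Cube N →₀ ℂ) →ₗ[ℂ] ℂ) ∘ₗ
        (MonoidAlgebra.coeffLinearEquiv ℂ).toLinearMap).lTensor (PolObar N)
      (coaction N (MonoidAlgebra.of ℂ (Cube N) (cubeElt A))))

/-- The degree `r` component of the magic representation, acting on
`span(g_A : |A| = r) ⊂ C*(ℤ₂^N)`. -/
def magicComponent (N r : ℕ) : Matrix {A : Finset (Fin N) // A.card = r}
    {A : Finset (Fin N) // A.card = r} (PolObar N) :=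
  Matrix.of fun A B => coactCoeff A.1 B.1

/-- The permutations `σ ∈ S_N` which are the identity outside of `A`. -/
def permsOn {N : ℕ} (A : Finset (Fin N)) : Finset (Equiv.Perm (Fin N)) :=
  Finset.univ.filter fun σ => ∀ a, a ∉ A → σ a = a

/-- The product `∏_{a ∈ A} u_{aσ(a)}` in `C(Ō_N)`, taken in increasing order of `a`. -/
def orderedProd {N : ℕ} (A : Finset (Fin N)) (σ : Equiv.Perm (Fin N)) : PolObar N :=
  ((A.sort (· ≤ ·)).map fun a => ubar N a (σ a)).prod

/-- `∑_{|A| = r} ∑_{σ ∈ S_N^A} ∏_{a ∈ A} u_{aσ(a)}`, in `C(Ō_N)`. -/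
def chiBar (N r : ℕ) : PolObar N :=
  ∑ A ∈ Finset.univ.powersetCard r, ∑ σ ∈ permsOn A, orderedProd A σ

/-! ### The orthogonal group and its antisymmetric representations -/

/-- The orthogonal group `O_N`. -/
abbrev O (N : ℕ) : Type := Matrix.orthogonalGroup (Fin N) ℝ

/-- The standard coordinates of `O_N`, as continuous functions. -/
def coord (N : ℕ) (i j : Fin N) : C(O N, ℂ) :=
  ⟨fun g => ((g : Matrix (Fin N) (Fin N) ℝ) i j : ℂ),
    Complex.continuous_ofReal.comp (continuous_subtype_val.matrix_elem i j)⟩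

/-- The algebra of representative functions on `O_N`, generated by the standard coordinates. -/
def polO (N : ℕ) : Subalgebra ℂ C(O N, ℂ) :=
  Algebra.adjoin ℂ (Set.range fun p : Fin N × Fin N => coord N p.1 p.2)

/-- The algebra `polO N` as a type. -/
abbrev PolO (N : ℕ) : Type := polO N

/-- The standard coordinates `u_{ij}` of `O_N`. -/
def uO (N : ℕ) : Matrix (Fin N) (Fin N) (PolO N) := Matrix.of fun i j =>
  ⟨coord N i j, Algebra.subset_adjoin ⟨(i, j), rfl⟩⟩

/-- The value of a representative function at a point of `O_N`. -/
def evalO {N : ℕ} (x : PolO N) (g : O N) : ℂ := (x : C(O N, ℂ)) g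

/-- Finite dimensional representations of `O_N`, in matrix form. -/
structure IsRep {N : ℕ} {n : Type*} [Fintype n] [DecidableEq n]
    (ρ : Matrix n n (PolO N)) : Prop where
  mul : ∀ g h i j, evalO (ρ i j) (g * h) = ∑ k, evalO (ρ i k) g * evalO (ρ k j) h
  one : ∀ i j, evalO (ρ i j) 1 = if i = j then 1 else 0

/-- `∑_{|A| = r} ∑_{σ ∈ S_N^A} ε(σ) ∏_{a ∈ A} u_{aσ(a)}`, in `C(O_N)`. -/
def chiO (N r : ℕ) : PolO N :=
  ∑ A ∈ Finset.univ.powersetCard r, ∑ σ ∈ permsOn A,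
    ((Equiv.Perm.sign σ : ℤ) : ℂ) • ∏ a ∈ A, uO N a (σ a)

/-- The tensor power `(ℂ^N)^{⊗ r}`. -/
abbrev TensorPow (N r : ℕ) : Type := ⨂[ℂ] _ : Fin r, (Fin N → ℂ)

/-- The linear map of `ℂ^N` given by `g ∈ O_N`. -/
def stdAct {N : ℕ} (g : O N) : (Fin N → ℂ) →ₗ[ℂ] (Fin N → ℂ) :=
  Matrix.toLin' ((g : Matrix (Fin N) (Fin N) ℝ).map Complex.ofReal)

theorem stdAct_one {N : ℕ} : stdAct (1 : O N) = LinearMap.id := by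
  simp [stdAct, Matrix.map_one]

theorem stdAct_mul {N : ℕ} (g h : O N) : stdAct (g * h) = stdAct g ∘ₗ stdAct h := by
  rw [stdAct, stdAct, stdAct, ← Matrix.toLin'_mul]
  congr 1
  exact Matrix.map_mul (f := Complex.ofRealHom)

/-- The action `g ↦ g^{⊗ r}` of `O_N` on `(ℂ^N)^{⊗ r}`. -/
def tensorRep (N r : ℕ) : Representation ℂ (O N) (TensorPow N r) where
  toFun g := PiTensorProduct.map fun _ => stdAct g
  map_one' := by
    simp only [stdAct_one]
    exact PiTensorProduct.map_id
  map_mul' g h := by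
    simp only [stdAct_mul]
    exact PiTensorProduct.map_comp _ _

/-- The antisymmetric vector
`ξ_{i_1 … i_r} = ∑_{σ ∈ S_r} ε(σ) e_{i_{σ(1)}} ⊗ … ⊗ e_{i_{σ(r)}}`. -/
def xi {N r : ℕ} (i : Fin r → Fin N) : TensorPow N r :=
  ∑ σ : Equiv.Perm (Fin r), ((Equiv.Perm.sign σ : ℤ) : ℂ) •
    PiTensorProduct.tprod ℂ fun k => (Pi.single (i (σ k)) 1 : Fin N → ℂ)

/-- The space `X_r = span(ξ_{i_1 … i_r} | i_1 < … < i_r)` of antisymmetric vectors. -/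
def antisym (N r : ℕ) : Submodule ℂ (TensorPow N r) :=
  Submodule.span ℂ (Set.range fun i : Fin r ↪o Fin N => xi i)

/-- The antisymmetrization of simple tensors, as an alternating map. -/
def alt (N r : ℕ) : (Fin N → ℂ) [⋀^Fin r]→ₗ[ℂ] TensorPow N r :=
  MultilinearMap.alternatization (PiTensorProduct.tprod ℂ)

theorem alt_apply {N r : ℕ} (v : Fin r → Fin N → ℂ) : alt N r v =
    ∑ σ : Equiv.Perm (Fin r), ((Equiv.Perm.sign σ : ℤ) : ℂ) •
      PiTensorProduct.tprod ℂ fun k => v (σ k) := by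
  rw [alt, MultilinearMap.alternatization_apply]
  refine Finset.sum_congr rfl fun σ _ => ?_
  rcases Int.units_eq_one_or (Equiv.Perm.sign σ) with h | h
  · rw [h]
    simp
  · rw [h]
    simp only [Units.neg_smul, one_smul, Units.val_neg, Units.val_one, Int.cast_neg, Int.cast_one]
    exact (neg_one_smul ℂ _).symm

theorem xi_eq_alt {N r : ℕ} (i : Fin r → Fin N) :
    xi i = alt N r fun k => Pi.single (i k) 1 := by
  rw [alt_apply, xi]

theorem xi_mem {N r : ℕ} (i : Fin r → Fin N) : xi i ∈ antisym N r := by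
  by_cases hi : Function.Injective i
  · have hs : StrictMono (i ∘ Tuple.sort i) :=
      (Tuple.monotone_sort i).strictMono_of_injective (hi.comp (Tuple.sort i).injective)
    have hmem : xi (i ∘ Tuple.sort i) ∈ antisym N r :=
      Submodule.subset_span ⟨OrderEmbedding.ofStrictMono _ hs, rfl⟩
    have hp := (alt N r).map_perm (fun k => (Pi.single (i k) 1 : Fin N → ℂ)) (Tuple.sort i)
    have h2 : xi (i ∘ Tuple.sort i) = Equiv.Perm.sign (Tuple.sort i) • xi i := by
      rw [xi_eq_alt, xi_eq_alt, ← hp]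
      rfl
    rw [h2] at hmem
    rcases Int.units_eq_one_or (Equiv.Perm.sign (Tuple.sort i)) with h | h <;>
      rw [h] at hmem
    · simpa using hmem
    · simpa using hmem
  · rw [Function.not_injective_iff] at hi
    obtain ⟨a, b, hab, hne⟩ := hi
    rw [xi_eq_alt, (alt N r).map_eq_zero_of_eq _ (by rw [hab]) hne]
    exact Submodule.zero_mem _

theorem alt_mem {N r : ℕ} (v : Fin r → Fin N → ℂ) : alt N r v ∈ antisym N r := by
  have hv : v = fun k => ∑ j, v k j • (Pi.single j 1 : Fin N → ℂ) := by
    funext k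
    exact pi_eq_sum_univ' (v k)
  have hs := (alt N r).toMultilinearMap.map_sum
    (fun k j => v k j • (Pi.single j 1 : Fin N → ℂ))
  rw [hv]
  refine (congrArg (· ∈ antisym N r) hs).mpr (Submodule.sum_mem _ fun i _ => ?_)
  rw [MultilinearMap.map_smul_univ]
  refine Submodule.smul_mem _ _ ?_
  have := xi_mem i
  rwa [xi_eq_alt] at this

theorem tensorRep_mem {N r : ℕ} (g : O N) {x : TensorPow N r} (hx : x ∈ antisym N r) :
    tensorRep N r g x ∈ antisym N r := by
  induction hx using Submodule.span_induction with
  | mem x h =>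
    obtain ⟨i, rfl⟩ := h
    have : tensorRep N r g (xi i) = alt N r fun k => stdAct g (Pi.single (i k) 1) := by
      rw [alt_apply, xi, map_sum]
      refine Finset.sum_congr rfl fun σ _ => ?_
      rw [map_smul]
      congr 1
      exact PiTensorProduct.map_tprod _ _
    rw [this]
    exact alt_mem _
  | zero => rw [map_zero]; exact Submodule.zero_mem _
  | add x y _ _ hx hy => rw [map_add]; exact Submodule.add_mem _ hx hy
  | smul c x _ hx => rw [map_smul]; exact Submodule.smul_mem _ _ hx

/-- The `r`-th antisymmetric representation of `O_N`, on the space `X_r`. -/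
def antisymRep (N r : ℕ) : Representation ℂ (O N) (antisym N r) where
  toFun g := (tensorRep N r g).restrict fun _ hx => tensorRep_mem g hx
  map_one' := by
    ext x
    simp
  map_mul' g h := by
    ext x
    simp

/-- The full antisymmetric representation `⊕_{r=0}^N X_r` of `O_N`. -/
def fullAntisymRep (N : ℕ) :
    Representation ℂ (O N) (⨁ r : Fin (N + 1), antisym N (r : ℕ)) :=
  Representation.directSum fun r : Fin (N + 1) => antisymRep N (r : ℕ)

/-! ### The twisting correspondence -/

/-- The diagonal matrix with given entries `±1`, as an element of `O_N`. -/
def signDiag {N : ℕ} (d : Fin N → ℤˣ) : O N :=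
  ⟨Matrix.diagonal fun i => ((d i : ℤ) : ℝ), by
    rw [Matrix.mem_orthogonalGroup_iff, Matrix.diagonal_transpose, Matrix.diagonal_mul_diagonal,
      ← Matrix.diagonal_one]
    congr 1
    funext i
    rcases Int.units_eq_one_or (d i) with h | h <;> simp [h]⟩

/-- `x` has bidegree `(S, T)` for the left and right translations by the subgroup
`ℤ₂^N ⊂ O_N` of diagonal sign matrices, whose dual group is identified with the set of subsets
of `{1, …, N}`. For instance `u_{ij}` has bidegree `({i}, {j})`. -/
def HasBidegree {N : ℕ} (S T : Finset (Fin N)) (x : PolO N) : Prop :=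
  ∀ (d e : Fin N → ℤˣ) (g : O N), evalO x (signDiag d * g * signDiag e) =
    (∏ i ∈ S, (((d i : ℤ)) : ℂ)) * (∏ j ∈ T, (((e j : ℤ)) : ℂ)) * evalO x g

/-- The bicharacter (in particular, 2-cocycle) on the dual of `ℤ₂^N` with value `-1` on a pair
of generators `(a, b)` with `a > b`, and `1` on the other pairs of generators. -/
def cocycle {N : ℕ} (S S' : Finset (Fin N)) : ℂ :=
  (-1) ^ ((S ×ˢ S').filter fun p => p.2 < p.1).card

/-- `θ` identifies `Ō_N` with the cocycle twist of `O_N` by the bicharacter `cocycle` of the dual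
of the diagonal subgroup `ℤ₂^N ⊂ O_N`: it matches the coordinates, and turns the product of
`PolO N`, deformed by the cocycle on both sides, into the product of `PolObar N`. -/
structure IsTwist {N : ℕ} (θ : PolO N ≃ₗ[ℂ] PolObar N) : Prop where
  map_one : θ 1 = 1
  map_coord : ∀ i j, θ (uO N i j) = ubar N i j
  map_mul : ∀ (S T S' T' : Finset (Fin N)) (x y : PolO N),
    HasBidegree S T x → HasBidegree S' T' y →
      θ x * θ y = (cocycle S S' * cocycle T T') • θ (x * y)

/-- The representation `ρ` of `O_N` and the matrix representation `w` of `Ō_N` correspond to each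
other via `θ`: in a suitable basis, the matrix coefficients of `ρ` are mapped by `θ` to the
entries of `w`. -/
def Corresponds {N : ℕ} (θ : PolO N ≃ₗ[ℂ] PolObar N) {V : Type*} [AddCommMonoid V] [Module ℂ V]
    (ρ : Representation ℂ (O N) V) {n : Type*} [Fintype n] [DecidableEq n]
    (w : Matrix n n (PolObar N)) : Prop :=
  ∃ (b : Module.Basis n ℂ V) (c : Matrix n n (PolO N)),
    (∀ g i j, LinearMap.toMatrix b b (ρ g) i j = evalO (c i j) g) ∧ c.map θ = w

end TwistedOrth

end

open TwistedOrth

/-!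
The twisted group algebra of the bidegree group `ℤ₂^N × ℤ₂^N`, represented by matrices of signs,
contains elements which commute or anticommute exactly as the coordinates of `Ō_N` do, up to the
commutation of the coordinates of `O_N`. Multiplying by them entrywise exchanges the solutions of
the two sets of relations, so that a linear combination of words in the `u_{ij}` vanishes if and
only if the same combination of the words in the `ū_{ij}`, corrected by signs, does. This gives `θ`.
It is compatible with the comultiplications since the sign of the word with rows `i` and columns
`j` is a product `s(i) s(j)`, so that the middle sign `s(k)` appears squared in `Δ`.

The representations `θ(ρ ⊗ τ)` and `θ(ρ) ⊗ θ(τ)` are intertwined by the cocycle, acting on the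
isotypic components of `ρ ⊗ τ` under the diagonal sign matrices. The coefficient of `g_B` in
`Φ(g_A)`, averaged over the orderings of `A`, is the image under `θ` of the `A × B` minor of `u`,
which is a coefficient of `X_r`. Finally `w` is the conjugate of this matrix of coefficients by the
Fourier matrix.
-/

open scoped symmDiff

namespace TwistedOrth

noncomputable section

/-! ### Signs of words -/

section Sign

variable {α : Type*}

/-- The bicharacter `cocycle` on a pair of generators: `-1` if they are out of order. -/
def ordSign [LinearOrder α] (a b : α) : ℂ := if b < a then -1 else 1

theorem ordSign_mul_self [LinearOrder α] (a b : α) : ordSign a b * ordSign a b = 1 := by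
  unfold ordSign; split_ifs <;> norm_num

theorem ordSign_self [LinearOrder α] (a : α) : ordSign a a = 1 := by simp [ordSign]

theorem ordSign_swap [LinearOrder α] {a b : α} (h : a ≠ b) : ordSign a b = -ordSign b a := by
  rcases lt_or_gt_of_ne h with h | h <;> simp [ordSign, h, h.le]

theorem prod_symmDiff_of_mul_self {M : Type*} [DecidableEq α] [CommMonoid M] {f : α → M}
    (hf : ∀ a, f a * f a = 1) (S T : Finset α) :
    ∏ a ∈ S ∆ T, f a = (∏ a ∈ S, f a) * ∏ a ∈ T, f a := by
  have hST : (∏ a ∈ S ∩ T, f a) * ∏ a ∈ S ∩ T, f a = 1 := by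
    rw [← Finset.prod_mul_distrib]
    exact Finset.prod_eq_one fun a _ => hf a
  rw [show S ∆ T = (S \ T) ∪ (T \ S) from rfl, Finset.prod_union disjoint_sdiff_sdiff,
    ← Finset.prod_inter_mul_prod_sdiff S T f, ← Finset.prod_inter_mul_prod_sdiff T S f,
    Finset.inter_comm T S, mul_mul_mul_comm, hST, one_mul]

/-- The set of letters which appear an odd number of times in a list. -/
def parity [DecidableEq α] : List α → Finset α
  | [] => ∅
  | i :: l => {i} ∆ parity l

theorem parity_append [DecidableEq α] (l l' : List α) :
    parity (l ++ l') = parity l ∆ parity l' := by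
  induction l with
  | nil => exact (bot_symmDiff _).symm
  | cons i l ih => simp [parity, ih, symmDiff_assoc]

theorem prod_parity {M : Type*} [DecidableEq α] [CommMonoid M] {f : α → M}
    (hf : ∀ a, f a * f a = 1) (l : List α) : ∏ a ∈ parity l, f a = (l.map f).prod := by
  induction l with
  | nil => simp [parity]
  | cons i l ih => rw [parity, prod_symmDiff_of_mul_self hf, ih]; simp

theorem parity_ofFn_of_injective [DecidableEq α] {r : ℕ} {k : Fin r → α}
    (hk : Function.Injective k) : parity (List.ofFn k) = Finset.univ.image k := by
  induction r with
  | zero => simp [parity]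
  | succ r ih =>
    have hd : Disjoint {k 0} (Finset.univ.image fun i : Fin r => k i.succ) := by
      rw [Finset.disjoint_singleton_left, Finset.mem_image]
      rintro ⟨y, -, hy⟩
      exact Fin.succ_ne_zero y (hk hy)
    rw [List.ofFn_succ, parity, ih (k := fun i => k i.succ) (hk.comp (Fin.succ_injective r)),
      hd.symmDiff_eq_sup]
    ext x
    simp [Fin.exists_fin_succ, eq_comm]

end Sign

variable {N : ℕ}

theorem cocycle_eq_prod (S T : Finset (Fin N)) :
    cocycle S T = ∏ a ∈ S, ∏ b ∈ T, ordSign a b := by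
  rw [← Finset.prod_product', cocycle]
  simp [ordSign, Finset.prod_ite]

theorem cocycle_mul_self (S T : Finset (Fin N)) : cocycle S T * cocycle S T = 1 := by
  rw [cocycle, ← mul_pow]; norm_num

theorem cocycle_symmDiff_left (S S' T : Finset (Fin N)) :
    cocycle (S ∆ S') T = cocycle S T * cocycle S' T := by
  simp only [cocycle_eq_prod]
  refine prod_symmDiff_of_mul_self (fun a => ?_) S S'
  rw [← Finset.prod_mul_distrib]
  exact Finset.prod_eq_one fun b _ => ordSign_mul_self a b

theorem cocycle_symmDiff_right (S T T' : Finset (Fin N)) :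
    cocycle S (T ∆ T') = cocycle S T * cocycle S T' := by
  simp only [cocycle_eq_prod, ← Finset.prod_mul_distrib]
  exact Finset.prod_congr rfl fun a _ => prod_symmDiff_of_mul_self (ordSign_mul_self a) T T'

theorem cocycle_empty_left (T : Finset (Fin N)) : cocycle ∅ T = 1 := by simp [cocycle]

theorem cocycle_empty_right (S : Finset (Fin N)) : cocycle S ∅ = 1 := by simp [cocycle]

theorem cocycle_singleton (a b : Fin N) : cocycle {a} {b} = ordSign a b := by
  simp [cocycle_eq_prod]

theorem star_cocycle (S T : Finset (Fin N)) : star (cocycle S T) = cocycle S T := by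
  simp [cocycle]

/-- The sign `(-1)^inv` of a list of indices, with `inv` its number of inversions. -/
def listSign : List (Fin N) → ℂ
  | [] => 1
  | i :: l => cocycle {i} (parity l) * listSign l

theorem listSign_append (l l' : List (Fin N)) :
    listSign (l ++ l') = listSign l * listSign l' * cocycle (parity l) (parity l') := by
  induction l with
  | nil => simp [parity, listSign, cocycle_empty_left]
  | cons i l ih =>
    simp only [List.cons_append, listSign, ih, parity_append, parity, cocycle_symmDiff_right,
      cocycle_symmDiff_left]
    ring

theorem listSign_mul_self (l : List (Fin N)) : listSign l * listSign l = 1 := by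
  induction l with
  | nil => simp [listSign]
  | cons i l ih => rw [listSign, mul_mul_mul_comm, ih, cocycle_mul_self, one_mul]

theorem listSign_ofFn {r : ℕ} (k : Fin r → Fin N) :
    listSign (List.ofFn k) = ∏ i, ∏ j ∈ Finset.Ioi i, ordSign (k i) (k j) := by
  induction r with
  | zero => simp [listSign]
  | succ r ih =>
    rw [List.ofFn_succ, listSign, ih, cocycle_eq_prod, Finset.prod_singleton,
      prod_parity (ordSign_mul_self _), List.map_ofFn, List.prod_ofFn, Fin.prod_univ_succ]
    congr 1
    · rw [Fin.prod_Ioi_zero]; rfl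
    · exact Finset.prod_congr rfl fun i _ => by rw [Fin.prod_Ioi_succ]

theorem listSign_ofFn_comp_perm {r : ℕ} (a : Fin r ↪o Fin N) (σ : Equiv.Perm (Fin r)) :
    listSign (List.ofFn fun t => a (σ t)) = ((Equiv.Perm.sign σ : ℤ) : ℂ) := by
  rw [listSign_ofFn, Equiv.Perm.sign_eq_prod_prod_Ioi]
  push_cast
  refine Finset.prod_congr rfl fun i _ => Finset.prod_congr rfl fun j hj => ?_
  have hne : σ i ≠ σ j := fun h => (Finset.mem_Ioi.1 hj).ne (σ.injective h)
  rcases lt_or_gt_of_ne hne with h | h <;> simp [ordSign, h, h.not_gt]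

/-- The dual of `ℤ₂^N × ℤ₂^N`, as pairs of sets of indices with the group law `∆`. -/
abbrev Bidegree (N : ℕ) : Type := Finset (Fin N) × Finset (Fin N)

/-- The bicharacter of `Bidegree N` by which both sides of `PolO N` are twisted. -/
def bicocycle (p q : Bidegree N) : ℂ := cocycle p.1 q.1 * cocycle p.2 q.2

theorem bicocycle_mul_self (p q : Bidegree N) : bicocycle p q * bicocycle p q = 1 := by
  rw [bicocycle, mul_mul_mul_comm, cocycle_mul_self, cocycle_mul_self, one_mul]

theorem bicocycle_symmDiff_left (p p' q : Bidegree N) :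
    bicocycle (p ∆ p') q = bicocycle p q * bicocycle p' q := by
  simp only [bicocycle, ← mul_mul_mul_comm, ← cocycle_symmDiff_left]
  rfl

theorem bicocycle_symmDiff_right (p q q' : Bidegree N) :
    bicocycle p (q ∆ q') = bicocycle p q * bicocycle p q' := by
  simp only [bicocycle, ← mul_mul_mul_comm, ← cocycle_symmDiff_right]
  rfl

theorem bicocycle_bot_left (q : Bidegree N) : bicocycle ⊥ q = 1 := by
  simp [bicocycle, cocycle_empty_left]

theorem bicocycle_bot_right (p : Bidegree N) : bicocycle p ⊥ = 1 := by
  simp [bicocycle, cocycle_empty_right]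

theorem bicocycle_singleton (i j k l : Fin N) :
    bicocycle ({i}, {j}) ({k}, {l}) = ordSign i k * ordSign j l := by
  rw [bicocycle, cocycle_singleton, cocycle_singleton]

theorem star_bicocycle (p q : Bidegree N) : star (bicocycle p q) = bicocycle p q := by
  rw [bicocycle, star_mul', star_cocycle, star_cocycle]

/-- The product `x_{i₁j₁} ⋯ x_{iₙjₙ}` of entries of `x` given by a word `(i₁, j₁) … (iₙ, jₙ)`. -/
def wordProd {ι κ B : Type*} [Monoid B] (x : Matrix ι κ B) (l : List (ι × κ)) : B :=
  (l.map fun p => x p.1 p.2).prod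

section WordProd

variable {ι κ B : Type*} [Monoid B] (x : Matrix ι κ B)

theorem wordProd_nil : wordProd x [] = 1 := List.prod_nil

theorem wordProd_cons (p : ι × κ) (l : List (ι × κ)) :
    wordProd x (p :: l) = x p.1 p.2 * wordProd x l := List.prod_cons

theorem wordProd_singleton (i : ι) (j : κ) : wordProd x [(i, j)] = x i j := List.prod_singleton

theorem wordProd_append (l l' : List (ι × κ)) :
    wordProd x (l ++ l') = wordProd x l * wordProd x l' := by
  simp [wordProd]

theorem map_wordProd {C F : Type*} [Monoid C] [FunLike F B C] [MonoidHomClass F B C] (f : F)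
    (l : List (ι × κ)) : f (wordProd x l) = wordProd (x.map f) l := by
  rw [wordProd, map_list_prod, List.map_map]
  rfl

end WordProd

/-- The sign of a word, by which a word in `uO N` and a word in `ubar N` differ. -/
def wordSign (l : List (Fin N × Fin N)) : ℂ :=
  listSign (l.map Prod.fst) * listSign (l.map Prod.snd)

/-- The bidegree of a word in the coordinates. -/
def wordBidegree (l : List (Fin N × Fin N)) : Bidegree N :=
  (parity (l.map Prod.fst), parity (l.map Prod.snd))

theorem wordSign_nil : wordSign ([] : List (Fin N × Fin N)) = 1 := one_mul 1

theorem wordSign_singleton (p : Fin N × Fin N) : wordSign [p] = 1 := by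
  simp [wordSign, listSign, parity, cocycle_empty_right]

theorem wordSign_mul_self (l : List (Fin N × Fin N)) : wordSign l * wordSign l = 1 := by
  rw [wordSign, mul_mul_mul_comm, listSign_mul_self, listSign_mul_self, one_mul]

theorem wordSign_append (l l' : List (Fin N × Fin N)) : wordSign (l ++ l') =
    wordSign l * wordSign l' * bicocycle (wordBidegree l) (wordBidegree l') := by
  simp only [wordSign, List.map_append, listSign_append, bicocycle, wordBidegree]
  ring

theorem wordSign_cons (p : Fin N × Fin N) (l : List (Fin N × Fin N)) :
    wordSign (p :: l) = bicocycle ({p.1}, {p.2}) (wordBidegree l) * wordSign l := by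
  simp only [wordSign, List.map_cons, listSign, bicocycle, wordBidegree]
  ring

/-! ### Tensoring with the twisted group algebra -/

/-- A matrix over a *-ring is real orthogonal if its entries are self-adjoint and
`x xᵗ = xᵗ x = 1`. The entries are not required to commute. -/
structure IsRealOrthogonal {B : Type*} [Ring B] [StarRing B] (x : Matrix (Fin N) (Fin N) B) :
    Prop where
  selfAdjoint : ∀ i j, star (x i j) = x i j
  row_orthogonal : ∀ i j, ∑ k, x i k * x j k = if i = j then 1 else 0
  col_orthogonal : ∀ i j, ∑ k, x k i * x k j = if i = j then 1 else 0

theorem IsTwistedOrthogonal.isRealOrthogonal {B : Type*} [Ring B] [StarRing B]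
    {x : Matrix (Fin N) (Fin N) B} (h : IsTwistedOrthogonal x) : IsRealOrthogonal x :=
  ⟨h.selfAdjoint, h.row_orthogonal, h.col_orthogonal⟩

section TwistMat

variable {B : Type*} [Ring B] [Algebra ℂ B]

/-- The map `x ↦ x ⊗ λ_p`, where `λ_p` is the basis element of the group algebra of `Bidegree N`
twisted by `bicocycle`, in its regular representation `λ_p e_q = bicocycle p q • e_{p ∆ q}`. -/
def twistMat (p : Bidegree N) : B →ₗ[ℂ] CStarMatrix (Bidegree N) (Bidegree N) B where
  toFun x := CStarMatrix.ofMatrix (Matrix.of fun r q => if r = p ∆ q then bicocycle p q • x else 0)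
  map_add' x y := CStarMatrix.ext fun r q => by
    simp only [CStarMatrix.add_apply, CStarMatrix.ofMatrix_apply, Matrix.of_apply, smul_add]
    split_ifs
    · rfl
    · exact (add_zero 0).symm
  map_smul' c x := CStarMatrix.ext fun r q => by
    simp only [CStarMatrix.smul_apply, CStarMatrix.ofMatrix_apply, Matrix.of_apply, smul_ite,
      smul_zero, smul_comm c, RingHom.id_apply]

theorem twistMat_apply (p r q : Bidegree N) (x : B) :
    twistMat p x r q = if r = p ∆ q then bicocycle p q • x else 0 := rfl

theorem twistMat_mul (p p' : Bidegree N) (x y : B) :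
    twistMat p x * twistMat p' y = bicocycle p p' • twistMat (p ∆ p') (x * y) := by
  refine CStarMatrix.ext fun r q => ?_
  rw [CStarMatrix.mul_apply, CStarMatrix.smul_apply]
  simp only [twistMat_apply, mul_ite, mul_zero, Finset.sum_ite_eq', Finset.mem_univ, if_true,
    ite_mul, zero_mul, symmDiff_assoc]
  split_ifs
  · rw [smul_mul_smul_comm, smul_smul, bicocycle_symmDiff_left, bicocycle_symmDiff_right]
    congr 1; ring
  · rw [smul_zero]

theorem twistMat_one : twistMat (⊥ : Bidegree N) (1 : B) = 1 :=
  CStarMatrix.ext fun r q => by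
    rw [CStarMatrix.one_apply, twistMat_apply, bot_symmDiff, bicocycle_bot_left, one_smul]

theorem star_twistMat [StarRing B] [StarModule ℂ B] (p : Bidegree N) (x : B) :
    star (twistMat p x) = bicocycle p p • twistMat p (star x) :=
  CStarMatrix.ext fun r q => by
    rw [CStarMatrix.star_apply, CStarMatrix.smul_apply, twistMat_apply, twistMat_apply]
    by_cases h : q = p ∆ r
    · have h' : r = p ∆ q := by rw [h, symmDiff_symmDiff_cancel_left]
      rw [if_pos h, if_pos h', star_smul, star_bicocycle, smul_smul, h', bicocycle_symmDiff_right]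
    · have h' : r ≠ p ∆ q := by rintro rfl; exact h (symmDiff_symmDiff_cancel_left _ _).symm
      rw [if_neg h, if_neg h', star_zero, smul_zero]

/-- The twist `(x_{ij} ⊗ λ_{ij})` of the matrix `x`, which exchanges the solutions of the
relations of `O_N` with those of `Ō_N`. -/
def twist (x : Matrix (Fin N) (Fin N) B) :
    Matrix (Fin N) (Fin N) (CStarMatrix (Bidegree N) (Bidegree N) B) :=
  Matrix.of fun i j => twistMat ({i}, {j}) (x i j)

theorem twist_apply (x : Matrix (Fin N) (Fin N) B) (i j : Fin N) :
    twist x i j = twistMat ({i}, {j}) (x i j) := rfl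

theorem twist_mul (x : Matrix (Fin N) (Fin N) B) (i j k l : Fin N) :
    twist x i j * twist x k l =
      (ordSign i k * ordSign j l) • twistMat ({i} ∆ {k}, {j} ∆ {l}) (x i j * x k l) := by
  rw [twist_apply, twist_apply, twistMat_mul, bicocycle_singleton]
  rfl

theorem twist_mul_swap (x : Matrix (Fin N) (Fin N) B) (i j k l : Fin N) :
    twist x k l * twist x i j =
      (ordSign k i * ordSign l j) • twistMat ({i} ∆ {k}, {j} ∆ {l}) (x k l * x i j) := by
  rw [twist_mul, symmDiff_comm ({k} : Finset (Fin N)), symmDiff_comm ({l} : Finset (Fin N))]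

theorem wordProd_twist (x : Matrix (Fin N) (Fin N) B) (l : List (Fin N × Fin N)) :
    wordProd (twist x) l = wordSign l • twistMat (wordBidegree l) (wordProd x l) := by
  induction l with
  | nil => rw [wordProd_nil, wordProd_nil, wordSign_nil, one_smul]; exact twistMat_one.symm
  | cons p l ih =>
    rw [wordProd_cons, wordProd_cons, ih, mul_smul_comm, twist_apply, twistMat_mul, smul_smul,
      wordSign_cons, mul_comm]
    rfl

/-- The sum of the entries of the column `⊥`, which is a left inverse of each `twistMat p`. -/
def colSum (N : ℕ) (B : Type*) [Ring B] [Algebra ℂ B] :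
    CStarMatrix (Bidegree N) (Bidegree N) B →ₗ[ℂ] B where
  toFun M := ∑ r, M r ⊥
  map_add' M M' := by simp only [CStarMatrix.add_apply, Finset.sum_add_distrib]
  map_smul' c M := by simp only [CStarMatrix.smul_apply, Finset.smul_sum, RingHom.id_apply]

theorem colSum_twistMat (p : Bidegree N) (x : B) : colSum N B (twistMat p x) = x := by
  change ∑ r, twistMat p x r ⊥ = x
  simp only [twistMat_apply, symmDiff_bot, bicocycle_bot_right, one_smul, Finset.sum_ite_eq',
    Finset.mem_univ, if_true]

theorem colSum_wordProd_twist (x : Matrix (Fin N) (Fin N) B) (l : List (Fin N × Fin N)) :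
    colSum N B (wordProd (twist x) l) = wordSign l • wordProd x l := by
  rw [wordProd_twist, map_smul, colSum_twistMat]

variable [StarRing B] {x : Matrix (Fin N) (Fin N) B}

theorem IsRealOrthogonal.twist [StarModule ℂ B] (h : IsRealOrthogonal x) :
    IsRealOrthogonal (twist x) where
  selfAdjoint i j := by
    rw [twist_apply, star_twistMat, h.selfAdjoint, bicocycle_singleton, ordSign_self,
      ordSign_self, one_mul, one_smul]
  row_orthogonal i j := by
    simp only [twist_mul, ordSign_self, mul_one, symmDiff_self, ← Finset.smul_sum, ← map_sum,
      h.row_orthogonal]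
    split_ifs with hij
    · subst hij
      rw [ordSign_self, one_smul, symmDiff_self]
      exact twistMat_one
    · rw [map_zero, smul_zero]
  col_orthogonal i j := by
    simp only [twist_mul, ordSign_self, one_mul, symmDiff_self, ← Finset.smul_sum, ← map_sum,
      h.col_orthogonal]
    split_ifs with hij
    · subst hij
      rw [ordSign_self, one_smul, symmDiff_self]
      exact twistMat_one
    · rw [map_zero, smul_zero]

theorem IsTwistedOrthogonal.commute_twist (h : IsTwistedOrthogonal x) (i j k l : Fin N) :
    Commute (twist x i j) (twist x k l) := by
  rw [commute_iff_eq, twist_mul, twist_mul_swap]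
  by_cases hik : i = k <;> by_cases hjl : j = l
  · rw [hik, hjl]
  · subst hik
    rw [h.row_anticomm i j l hjl, map_neg, ordSign_swap hjl, mul_neg, neg_smul_neg]
  · subst hjl
    rw [h.col_anticomm i k j hik, map_neg, ordSign_swap hik, neg_mul, neg_smul_neg]
  · rw [h.comm i k j l hik hjl, ordSign_swap hik, ordSign_swap hjl, neg_mul_neg]

theorem isTwistedOrthogonal_twist {B : Type*} [CommRing B] [StarRing B] [Algebra ℂ B]
    [StarModule ℂ B] {x : Matrix (Fin N) (Fin N) B} (h : IsRealOrthogonal x) :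
    IsTwistedOrthogonal (twist x) where
  selfAdjoint := h.twist.selfAdjoint
  row_orthogonal := h.twist.row_orthogonal
  col_orthogonal := h.twist.col_orthogonal
  row_anticomm i j l hjl := by
    rw [twist_mul, twist_mul_swap, ordSign_swap hjl, mul_comm (x i l), mul_neg, neg_smul]
  col_anticomm i k j hik := by
    rw [twist_mul, twist_mul_swap, ordSign_swap hik, mul_comm (x k j), neg_mul, neg_smul]
  comm i k j l hik hjl := by
    rw [twist_mul, twist_mul_swap, ordSign_swap hik, ordSign_swap hjl, mul_comm (x k l),
      neg_mul_neg]

end TwistMat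

/-! ### Linear relations between words -/

/-- The values of a representative function at a point of `O_N`, as a morphism of algebras. -/
def evalHom (g : O N) : PolO N →ₐ[ℂ] ℂ :=
  (ContinuousMap.evalAlgHom ℂ ℂ g).comp (polO N).val

theorem evalHom_apply (g : O N) (x : PolO N) : evalHom g x = evalO x g := rfl

theorem evalHom_uO (g : O N) (i j : Fin N) :
    evalHom g (uO N i j) = ((g : Matrix (Fin N) (Fin N) ℝ) i j : ℂ) := rfl

theorem map_evalHom_uO (g : O N) :
    (uO N).map (evalHom g) = (g : Matrix (Fin N) (Fin N) ℝ).map Complex.ofReal := rfl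

theorem PolO.ext {x y : PolO N} (h : ∀ g, evalHom g x = evalHom g y) : x = y :=
  Subtype.ext (ContinuousMap.ext h)

theorem isRealOrthogonal_map_ofReal (g : O N) :
    IsRealOrthogonal ((g : Matrix (Fin N) (Fin N) ℝ).map Complex.ofReal) where
  selfAdjoint _ _ := Complex.conj_ofReal _
  row_orthogonal i j := by
    have h := congrArg Complex.ofReal
      (congrFun₂ ((Matrix.mem_orthogonalGroup_iff _ _).1 g.2) i j)
    rw [Matrix.mul_apply, Matrix.one_apply] at h
    push_cast [apply_ite Complex.ofReal] at h
    exact h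
  col_orthogonal i j := by
    have h := congrArg Complex.ofReal
      (congrFun₂ ((Matrix.mem_orthogonalGroup_iff' _ _).1 g.2) i j)
    rw [Matrix.mul_apply, Matrix.one_apply] at h
    push_cast [apply_ite Complex.ofReal] at h
    exact h

theorem IsRealOrthogonal.exists_eq_map {A : Type*} [Ring A] [StarRing A] [Algebra ℂ A]
    {x : Matrix (Fin N) (Fin N) A} (hx : IsRealOrthogonal x) (φ : A →⋆ₐ[ℂ] ℂ) :
    ∃ g : O N, (g : Matrix (Fin N) (Fin N) ℝ).map Complex.ofReal = x.map φ := by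
  have hre : ∀ i j, ((φ (x i j)).re : ℂ) = φ (x i j) := fun i j => by
    have : star (φ (x i j)) = φ (x i j) := by rw [← map_star, hx.selfAdjoint]
    exact Complex.conj_eq_iff_re.1 this
  refine ⟨⟨Matrix.of fun i j => (φ (x i j)).re, (Matrix.mem_orthogonalGroup_iff _ _).2 ?_⟩,
    Matrix.ext hre⟩
  ext i j
  apply Complex.ofReal_injective
  rw [Matrix.mul_apply, Matrix.one_apply]
  simp only [Matrix.transpose_apply, Matrix.of_apply, Complex.ofReal_sum, Complex.ofReal_mul,
    hre, ← map_mul, ← map_sum, hx.row_orthogonal]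
  split_ifs <;> simp

open Finsupp

section Words

variable {ι κ A B : Type*} [Ring A] [Algebra ℂ A] [Ring B] [Algebra ℂ B]

theorem linearCombination_wordProd_map {F : Type*} [FunLike F A B] [AlgHomClass F ℂ A B] (f : F)
    (x : Matrix ι κ A) (c : List (ι × κ) →₀ ℂ) :
    linearCombination ℂ (wordProd (x.map f)) c = f (linearCombination ℂ (wordProd x) c) := by
  simp only [linearCombination_apply, Finsupp.sum, map_sum, map_smul, map_wordProd]

theorem span_wordProd (x : Matrix ι κ A) : Submodule.span ℂ (Set.range (wordProd x)) =
    Subalgebra.toSubmodule (Algebra.adjoin ℂ (Set.range fun p : ι × κ => x p.1 p.2)) := by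
  rw [Algebra.adjoin_eq_span, ← FreeMonoid.mrange_lift, MonoidHom.coe_mrange]
  congr 2
  funext l
  exact (FreeMonoid.lift_apply _ _).symm

theorem exists_linearMap_of_linearCombination {ι V W : Type*} [AddCommGroup V] [Module ℂ V]
    [AddCommGroup W] [Module ℂ W] {v : ι → V} {w : ι → W}
    (hv : Submodule.span ℂ (Set.range v) = ⊤)
    (h : ∀ c, linearCombination ℂ v c = 0 → linearCombination ℂ w c = 0) :
    ∃ f : V →ₗ[ℂ] W, ∀ i, f (v i) = w i := by
  have hs : Function.Surjective (linearCombination ℂ v) := by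
    rw [← LinearMap.range_eq_top, range_linearCombination, hv]
  have hker : LinearMap.ker (linearCombination ℂ v) ≤ LinearMap.ker (linearCombination ℂ w) := h
  refine ⟨(LinearMap.ker (linearCombination ℂ v)).liftQ (linearCombination ℂ w) hker ∘ₗ
    ((linearCombination ℂ v).quotKerEquivOfSurjective hs).symm.toLinearMap, fun i => ?_⟩
  have hi : ((linearCombination ℂ v).quotKerEquivOfSurjective hs).symm (v i) =
      Submodule.Quotient.mk (single i 1) := by
    rw [LinearEquiv.symm_apply_eq, LinearMap.quotKerEquivOfSurjective_apply_mk,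
      linearCombination_single, one_smul]
  rw [LinearMap.comp_apply, LinearEquiv.coe_coe, hi, Submodule.liftQ_apply,
    linearCombination_single, one_smul]

theorem exists_algHom_of_linearCombination_wordProd {x : Matrix ι κ A} {y : Matrix ι κ B}
    (hx : Submodule.span ℂ (Set.range (wordProd x)) = ⊤)
    (h : ∀ c, linearCombination ℂ (wordProd x) c = 0 → linearCombination ℂ (wordProd y) c = 0) :
    ∃ f : A →ₐ[ℂ] B, ∀ i j, f (x i j) = y i j := by
  obtain ⟨f, hf⟩ := exists_linearMap_of_linearCombination hx h
  have hmul : (LinearMap.mul ℂ A).compr₂ f = (LinearMap.mul ℂ B).compl₁₂ f f := by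
    refine LinearMap.ext_on hx ?_
    rintro _ ⟨l, rfl⟩
    refine LinearMap.ext_on hx ?_
    rintro _ ⟨l', rfl⟩
    change f (wordProd x l * wordProd x l') = f (wordProd x l) * f (wordProd x l')
    rw [← wordProd_append, hf, hf, hf, wordProd_append]
  refine ⟨AlgHom.ofLinearMap f ?_ fun a b => LinearMap.congr_fun₂ hmul a b, fun i j => ?_⟩
  · simpa only [wordProd_nil] using hf []
  · exact (congrArg f (wordProd_singleton x i j)).symm.trans
      ((hf [(i, j)]).trans (wordProd_singleton y i j))

end Words

theorem IsRealOrthogonal.linearCombination_wordProd_eq_zero {A : Type*} [CommCStarAlgebra A]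
    {x : Matrix (Fin N) (Fin N) A} (hx : IsRealOrthogonal x) {c : List (Fin N × Fin N) →₀ ℂ}
    (hc : linearCombination ℂ (wordProd (uO N)) c = 0) :
    linearCombination ℂ (wordProd x) c = 0 := by
  refine (gelfandTransform_isometry A).injective ?_
  rw [map_zero]
  ext φ
  rw [WeakDual.gelfandTransform_apply_apply, ContinuousMap.zero_apply,
    ← linearCombination_wordProd_map]
  obtain ⟨g, hg⟩ := hx.exists_eq_map (φ : A →⋆ₐ[ℂ] ℂ)
  have hx' : x.map φ = (uO N).map (evalHom g) := hg.symm.trans (map_evalHom_uO g).symm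
  rw [hx', linearCombination_wordProd_map, hc, map_zero]

/-- The closed *-algebra generated by the entries of `x` is commutative, so that its Gelfand
transform reduces the claim to points of `O_N`. -/
theorem IsRealOrthogonal.linearCombination_wordProd_eq_zero_of_commute {A : Type*} [CStarAlgebra A]
    {x : Matrix (Fin N) (Fin N) A} (hx : IsRealOrthogonal x)
    (hcomm : ∀ i j k l, Commute (x i j) (x k l)) {c : List (Fin N × Fin N) →₀ ℂ}
    (hc : linearCombination ℂ (wordProd (uO N)) c = 0) :
    linearCombination ℂ (wordProd x) c = 0 := by
  set R : Set A := Set.range fun q : Fin N × Fin N => x q.1 q.2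
  set C : StarSubalgebra ℂ A := (StarAlgebra.adjoin ℂ R).topologicalClosure
  have hclosed : IsClosed (C : Set A) := StarSubalgebra.isClosed_topologicalClosure _
  have hC : ∀ a b : C, a * b = b * a := by
    have := StarAlgebra.isMulCommutative_adjoin ℂ (s := R)
      (by rintro _ ⟨a, rfl⟩ _ ⟨b, rfl⟩; exact hcomm _ _ _ _)
      (by rintro _ ⟨a, rfl⟩ _ ⟨b, rfl⟩; rw [hx.selfAdjoint]; exact hcomm _ _ _ _)
    let := StarSubalgebra.commRingTopologicalClosure (StarAlgebra.adjoin ℂ R) mul_comm'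
    exact mul_comm (G := (StarAlgebra.adjoin ℂ R).topologicalClosure)
  let : CommCStarAlgebra C := { (inferInstance : CStarAlgebra C) with mul_comm := hC }
  let y : Matrix (Fin N) (Fin N) C := Matrix.of fun i j =>
    ⟨x i j, StarSubalgebra.le_topologicalClosure _ (StarAlgebra.subset_adjoin ℂ _ ⟨(i, j), rfl⟩)⟩
  have hy : IsRealOrthogonal y :=
    { selfAdjoint := fun i j => Subtype.ext (hx.selfAdjoint i j)
      row_orthogonal := fun i j => Subtype.ext <| by
        rw [AddSubmonoidClass.coe_finsetSum, apply_ite Subtype.val]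
        exact hx.row_orthogonal i j
      col_orthogonal := fun i j => Subtype.ext <| by
        rw [AddSubmonoidClass.coe_finsetSum, apply_ite Subtype.val]
        exact hx.col_orthogonal i j }
  have h := linearCombination_wordProd_map C.subtype y c
  rwa [hy.linearCombination_wordProd_eq_zero hc, map_zero] at h

theorem linearCombination_ubar_eq_zero {c : List (Fin N × Fin N) →₀ ℂ}
    (hc : linearCombination ℂ (wordProd (uO N)) c = 0) :
    linearCombination ℂ (fun l => wordSign l • wordProd (ubar N) l) c = 0 := by
  let : PartialOrder (CObar N) := CStarAlgebra.spectralOrder _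
  let : StarOrderedRing (CObar N) := CStarAlgebra.spectralOrderedRing _
  have hu := isTwistedOrthogonal_cCoord N
  have h := hu.isRealOrthogonal.twist.linearCombination_wordProd_eq_zero_of_commute
    hu.commute_twist hc
  refine Subtype.val_injective (p := (· ∈ polObar N)) ?_
  change (polObar N).subtype _ = 0
  have hcolSum := congrArg (colSum N (CObar N)) h
  simp only [linearCombination_apply, Finsupp.sum, map_sum, map_smul, colSum_wordProd_twist,
    map_zero, map_wordProd] at hcolSum ⊢
  exact hcolSum

open scoped ComplexOrder in
/-- The solution of the relations of `Ō_N` obtained by twisting a point of `O_N`. -/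
def pointSolution (g : O N) : Solution N where
  carrier := CStarMatrix (Bidegree N) (Bidegree N) ℂ
  entry := twist ((g : Matrix (Fin N) (Fin N) ℝ).map Complex.ofReal)
  rel := isTwistedOrthogonal_twist (isRealOrthogonal_map_ofReal g)

theorem linearCombination_uO_eq_zero {c : List (Fin N × Fin N) →₀ ℂ}
    (hc : linearCombination ℂ (fun l => wordSign l • wordProd (ubar N) l) c = 0) :
    linearCombination ℂ (wordProd (uO N)) c = 0 := by
  refine PolO.ext fun g => ?_
  let f : PolObar N →⋆ₐ[ℂ] CStarMatrix (Bidegree N) (Bidegree N) ℂ :=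
    (toSolution (pointSolution g)).comp (polObar N).subtype
  have hf : ∀ l, colSum N ℂ (f (wordSign l • wordProd (ubar N) l)) =
      evalHom g (wordProd (uO N) l) := fun l => by
    have hw : f (wordProd (ubar N) l) =
        wordProd (twist ((g : Matrix (Fin N) (Fin N) ℝ).map Complex.ofReal)) l :=
      map_wordProd (ubar N) f l
    rw [map_smul, hw, map_smul, colSum_wordProd_twist, smul_smul, wordSign_mul_self, one_smul,
      map_wordProd, map_evalHom_uO]
  have h := congrArg (fun x => colSum N ℂ (f x)) hc
  simp only [map_zero, linearCombination_apply, Finsupp.sum, map_sum, map_smul] at h ⊢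
  simpa only [← map_smul, ← hf] using h

/-! ### The twisting map -/

theorem span_wordProd_uO (N : ℕ) : Submodule.span ℂ (Set.range (wordProd (uO N))) = ⊤ := by
  have hrange : (Set.range fun p : Fin N × Fin N => uO N p.1 p.2) =
      Subtype.val ⁻¹' Set.range fun p : Fin N × Fin N => coord N p.1 p.2 :=
    Set.ext fun x => exists_congr fun p => Subtype.ext_iff
  refine (span_wordProd (uO N)).trans ?_
  rw [hrange]
  exact congrArg Subalgebra.toSubmodule Algebra.adjoin_adjoin_coe_preimage

theorem span_wordProd_ubar (N : ℕ) : Submodule.span ℂ (Set.range (wordProd (ubar N))) = ⊤ := by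
  set s : Set (PolObar N) := Set.range fun p : Fin N × Fin N => ubar N p.1 p.2
  have hstar : star s = s := by
    rw [← Set.image_star, ← Set.range_comp]
    exact congrArg Set.range (funext fun p => (isTwistedOrthogonal_ubar N).selfAdjoint p.1 p.2)
  rw [span_wordProd, eq_top_iff]
  rintro x -
  induction x using StarAlgebra.adjoin_induction_subtype with
  | mem x h =>
    obtain ⟨p, rfl⟩ := h
    exact Algebra.subset_adjoin ⟨p, rfl⟩
  | algebraMap c => exact Subalgebra.algebraMap_mem _ c
  | add x y h h' => exact Subalgebra.add_mem _ h h'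
  | mul x y h h' => exact Subalgebra.mul_mem _ h h'
  | star x h =>
    change x ∈ Algebra.adjoin ℂ s at h
    rwa [← hstar, ← Subalgebra.star_adjoin_comm] at h

theorem span_wordSign_smul_wordProd_ubar (N : ℕ) :
    Submodule.span ℂ (Set.range fun l => wordSign l • wordProd (ubar N) l) = ⊤ := by
  rw [eq_top_iff, ← span_wordProd_ubar, Submodule.span_le]
  rintro _ ⟨l, rfl⟩
  rw [← one_smul ℂ (wordProd _ l), ← wordSign_mul_self l, mul_smul]
  exact Submodule.smul_mem _ _ (Submodule.subset_span ⟨l, rfl⟩)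

theorem exists_linearEquiv_of_linearCombination {ι V W : Type*} [AddCommGroup V] [Module ℂ V]
    [AddCommGroup W] [Module ℂ W] {v : ι → V} {w : ι → W}
    (hv : Submodule.span ℂ (Set.range v) = ⊤) (hw : Submodule.span ℂ (Set.range w) = ⊤)
    (h : ∀ c, linearCombination ℂ v c = 0 ↔ linearCombination ℂ w c = 0) :
    ∃ e : V ≃ₗ[ℂ] W, ∀ i, e (v i) = w i := by
  obtain ⟨f, hf⟩ := exists_linearMap_of_linearCombination hv fun c => (h c).1
  obtain ⟨f', hf'⟩ := exists_linearMap_of_linearCombination hw fun c => (h c).2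
  refine ⟨.ofLinearMap f f' (LinearMap.ext_on_range hw fun i => ?_)
    (LinearMap.ext_on_range hv fun i => ?_), hf⟩
  · rw [LinearMap.comp_apply, hf', hf, LinearMap.id_apply]
  · rw [LinearMap.comp_apply, hf, hf', LinearMap.id_apply]

theorem exists_theta (N : ℕ) : ∃ θ : PolO N ≃ₗ[ℂ] PolObar N,
    ∀ l, θ (wordProd (uO N) l) = wordSign l • wordProd (ubar N) l :=
  exists_linearEquiv_of_linearCombination (V := PolO N) (W := PolObar N) (span_wordProd_uO N)
    (span_wordSign_smul_wordProd_ubar N) fun _ =>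
      ⟨fun h => linearCombination_ubar_eq_zero h, fun h => linearCombination_uO_eq_zero h⟩

/-- The twisting map `θ`, which sends the words in the coordinates of `O_N` to the corresponding
words in the coordinates of `Ō_N`, up to a sign. -/
def theta (N : ℕ) : PolO N ≃ₗ[ℂ] PolObar N := (exists_theta N).choose

theorem theta_wordProd (l : List (Fin N × Fin N)) :
    theta N (wordProd (uO N) l) = wordSign l • wordProd (ubar N) l :=
  (exists_theta N).choose_spec l

/-- The character of the group of diagonal sign matrices given by a set of indices. -/
def signChar (S : Finset (Fin N)) (d : Fin N → ℤˣ) : ℂ := ∏ i ∈ S, ((d i : ℤ) : ℂ)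

theorem intUnit_mul_self (e : ℤˣ) : ((e : ℤ) : ℂ) * ((e : ℤ) : ℂ) = 1 := by
  rcases Int.units_eq_one_or e with h | h <;> simp [h]

theorem signChar_symmDiff (S T : Finset (Fin N)) (d : Fin N → ℤˣ) :
    signChar (S ∆ T) d = signChar S d * signChar T d :=
  prod_symmDiff_of_mul_self (fun i => intUnit_mul_self (d i)) S T

theorem signChar_parity (l : List (Fin N)) (d : Fin N → ℤˣ) :
    signChar (parity l) d = (l.map fun i => ((d i : ℤ) : ℂ)).prod :=
  prod_parity (fun i => intUnit_mul_self (d i)) l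

theorem signChar_mul (S : Finset (Fin N)) (d e : Fin N → ℤˣ) :
    signChar S (d * e) = signChar S d * signChar S e := by
  simp [signChar, Finset.prod_mul_distrib]

theorem sum_signChar (S : Finset (Fin N)) :
    ∑ d, signChar S d = if S = ∅ then (2 : ℂ) ^ N else 0 := by
  have hfactor : ∀ i : Fin N, ∑ e : ℤˣ, (if i ∈ S then ((e : ℤ) : ℂ) else 1) =
      if i ∈ S then 0 else 2 := fun i => by
    rw [show (Finset.univ : Finset ℤˣ) = {1, -1} from rfl, Finset.sum_pair (by decide)]
    split_ifs <;> norm_num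
  have hsum : ∑ d, signChar S d = ∏ i, if i ∈ S then (0 : ℂ) else 2 := by
    simp only [← hfactor, Fintype.prod_sum, signChar, Fintype.prod_ite_mem]
  rw [hsum]
  split_ifs with hS
  · simp [hS]
  · obtain ⟨i, hi⟩ := Finset.nonempty_iff_ne_empty.2 hS
    exact Finset.prod_eq_zero (Finset.mem_univ i) (if_pos hi)

theorem sum_signChar_mul (S T : Finset (Fin N)) :
    ∑ d, signChar S d * signChar T d = if S = T then (2 : ℂ) ^ N else 0 := by
  simp only [← signChar_symmDiff, sum_signChar, ← Finset.bot_eq_empty, symmDiff_eq_bot]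

theorem hasBidegree_wordProd (l : List (Fin N × Fin N)) :
    HasBidegree (wordBidegree l).1 (wordBidegree l).2 (wordProd (uO N) l) := by
  intro d e g
  change _ = signChar (parity _) d * signChar (parity _) e * _
  rw [← evalHom_apply, ← evalHom_apply, map_wordProd, map_wordProd, signChar_parity,
    signChar_parity, wordProd, wordProd, List.map_map, List.map_map, ← List.prod_map_mul,
    ← List.prod_map_mul]
  congr 2
  funext p
  have hp : ((signDiag d * g * signDiag e : O N) : Matrix (Fin N) (Fin N) ℝ) p.1 p.2 =
      ((d p.1 : ℤ) : ℝ) * (g : Matrix (Fin N) (Fin N) ℝ) p.1 p.2 * ((e p.2 : ℤ) : ℝ) := by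
    change (Matrix.diagonal (fun i => ((d i : ℤ) : ℝ)) * (g : Matrix (Fin N) (Fin N) ℝ) *
      Matrix.diagonal fun i => ((e i : ℤ) : ℝ)) p.1 p.2 = _
    rw [Matrix.mul_diagonal, Matrix.diagonal_mul]
  simp only [Matrix.map_apply, evalHom_uO, hp, Function.comp_apply]
  push_cast
  ring

/-- The unnormalized projection onto the part of bidegree `p`, evaluated at `g`. -/
def bidegreeSum (p : Bidegree N) (g : O N) : PolO N →ₗ[ℂ] ℂ :=
  ∑ d, ∑ e, (signChar p.1 d * signChar p.2 e) • (evalHom (signDiag d * g * signDiag e)).toLinearMap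

theorem bidegreeSum_of_hasBidegree {q : Bidegree N} {x : PolO N} (hx : HasBidegree q.1 q.2 x)
    (p : Bidegree N) (g : O N) :
    bidegreeSum p g x = if q = p then (2 : ℂ) ^ N * 2 ^ N * evalHom g x else 0 := by
  have hterm : ∀ d e, signChar p.1 d * signChar p.2 e * evalHom (signDiag d * g * signDiag e) x =
      (signChar q.1 d * signChar p.1 d) * (signChar q.2 e * signChar p.2 e) * evalHom g x :=
    fun d e => by
      have h : evalHom (signDiag d * g * signDiag e) x =
          signChar q.1 d * signChar q.2 e * evalHom g x := hx d e g
      rw [h]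
      ring
  simp only [bidegreeSum, LinearMap.sum_apply, LinearMap.smul_apply, AlgHom.toLinearMap_apply,
    smul_eq_mul, hterm, ← Finset.sum_mul, ← Finset.mul_sum, sum_signChar_mul, Prod.ext_iff]
  by_cases h₁ : q.1 = p.1 <;> by_cases h₂ : q.2 = p.2 <;> simp [h₁, h₂]

theorem HasBidegree.mem_span {p : Bidegree N} {x : PolO N} (hx : HasBidegree p.1 p.2 x) :
    x ∈ Submodule.span ℂ (wordProd (uO N) '' {l | wordBidegree l = p}) := by
  obtain ⟨c, rfl⟩ : x ∈ LinearMap.range (linearCombination ℂ (wordProd (uO N))) := by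
    rw [range_linearCombination, span_wordProd_uO]; trivial
  have hfilter : ∀ g, bidegreeSum p g (linearCombination ℂ (wordProd (uO N)) c) = (2 : ℂ) ^ N *
      2 ^ N * evalHom g (linearCombination ℂ (wordProd (uO N)) (c.filter (wordBidegree · = p))) :=
    fun g => by
      clear hx
      induction c using Finsupp.induction_linear with
      | zero => rw [map_zero, filter_zero, map_zero, map_zero, map_zero, mul_zero]
      | add c c' hc hc' => rw [map_add, map_add, hc, hc', filter_add, map_add, map_add, mul_add]
      | single l a =>
        rw [linearCombination_single, map_smul, bidegreeSum_of_hasBidegree (hasBidegree_wordProd l)]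
        by_cases hl : wordBidegree l = p
        · rw [if_pos hl, filter_single_of_pos (wordBidegree · = p) hl, linearCombination_single,
            map_smul, smul_eq_mul, smul_eq_mul, mul_left_comm]
        · rw [if_neg hl, filter_single_of_neg (wordBidegree · = p) hl, map_zero, map_zero,
            smul_zero, mul_zero]
  refine (mem_span_image_iff_linearCombination ℂ).2 ⟨c.filter (wordBidegree · = p), ?_, ?_⟩
  · intro l hl
    rw [support_filter] at hl
    exact (Finset.mem_filter.1 hl).2
  · refine PolO.ext fun g => mul_left_cancel₀ (a := (2 : ℂ) ^ N * 2 ^ N) (by simp) ?_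
    rw [← hfilter, bidegreeSum_of_hasBidegree hx, if_pos rfl]

theorem theta_wordProd_mul_theta_wordProd (l l' : List (Fin N × Fin N)) :
    theta N (wordProd (uO N) l) * theta N (wordProd (uO N) l') =
      bicocycle (wordBidegree l) (wordBidegree l') •
        theta N (wordProd (uO N) l * wordProd (uO N) l') := by
  rw [← wordProd_append, theta_wordProd, theta_wordProd, theta_wordProd, wordSign_append,
    wordProd_append, smul_mul_smul_comm, smul_smul, mul_left_comm, bicocycle_mul_self, mul_one]

theorem theta_mul_theta {p q : Bidegree N} {x y : PolO N}
    (hx : x ∈ Submodule.span ℂ (wordProd (uO N) '' {l | wordBidegree l = p}))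
    (hy : y ∈ Submodule.span ℂ (wordProd (uO N) '' {l | wordBidegree l = q})) :
    theta N x * theta N y = bicocycle p q • theta N (x * y) := by
  induction hx, hy using Submodule.span_induction₂ with
  | mem_mem x y hx hy =>
    obtain ⟨l, rfl, rfl⟩ := hx
    obtain ⟨l', rfl, rfl⟩ := hy
    exact theta_wordProd_mul_theta_wordProd l l'
  | zero_left y _ => simp
  | zero_right x _ => simp
  | add_left x y z _ _ _ h h' => simp only [add_mul, map_add, h, h', smul_add]
  | add_right x y z _ _ _ h h' => simp only [mul_add, map_add, h, h', smul_add]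
  | smul_left r x y _ _ h => rw [map_smul, smul_mul_assoc, smul_mul_assoc, h, map_smul, smul_comm]
  | smul_right r x y _ _ h =>
    rw [map_smul, mul_smul_comm, mul_smul_comm, h, map_smul, smul_comm]

theorem isTwist_theta (N : ℕ) : IsTwist (theta N) where
  map_one := by
    have h := theta_wordProd (N := N) []
    rwa [wordSign_nil, one_smul] at h
  map_coord i j := by
    have h := theta_wordProd [(i, j)]
    rwa [wordProd_singleton, wordProd_singleton, wordSign_singleton, one_smul] at h
  map_mul S T S' T' _ _ hx hy := by
    have h := theta_mul_theta (HasBidegree.mem_span (p := (S, T)) hx)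
      (HasBidegree.mem_span (p := (S', T')) hy)
    rwa [bicocycle] at h

theorem IsTwist.eq_theta {θ : PolO N ≃ₗ[ℂ] PolObar N} (h : IsTwist θ) : θ = theta N := by
  refine LinearEquiv.toLinearMap_injective (LinearMap.ext_on_range (span_wordProd_uO N) fun l => ?_)
  change θ _ = theta N _
  induction l with
  | nil => exact h.map_one.trans (isTwist_theta N).map_one.symm
  | cons p l ih =>
    have hp : θ (wordProd (uO N) [p]) = theta N (wordProd (uO N) [p]) := by
      rw [wordProd_singleton, h.map_coord, (isTwist_theta N).map_coord]
    have hmul := h.map_mul _ _ _ _ _ _ (hasBidegree_wordProd [p]) (hasBidegree_wordProd l)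
    rw [hp, ih, theta_wordProd_mul_theta_wordProd, ← wordProd_append] at hmul
    exact (smul_right_injective _ (left_ne_zero_of_mul_eq_one (bicocycle_mul_self _ _)) hmul).symm

/-! ### Representations -/

theorem theta_symm_wordProd (l : List (Fin N × Fin N)) :
    (theta N).symm (wordProd (ubar N) l) = wordSign l • wordProd (uO N) l := by
  rw [LinearEquiv.symm_apply_eq, map_smul, theta_wordProd, smul_smul, wordSign_mul_self, one_smul]

/-- The linear form on `O(Ō_N)` which corresponds under `θ` to the evaluation at a point of
`O_N`. -/
def evalBar (g : O N) : PolObar N →ₗ[ℂ] ℂ :=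
  (evalHom g).toLinearMap ∘ₗ (theta N).symm.toLinearMap

theorem evalBar_theta (g : O N) (x : PolO N) : evalBar g (theta N x) = evalHom g x :=
  congrArg (evalHom g) ((theta N).symm_apply_apply x)

theorem evalBar_wordProd (g : O N) (l : List (Fin N × Fin N)) : evalBar g (wordProd (ubar N) l) =
    wordSign l * wordProd ((g : Matrix (Fin N) (Fin N) ℝ).map Complex.ofReal) l := by
  change evalHom g ((theta N).symm _) = _
  rw [theta_symm_wordProd, map_smul, map_wordProd, map_evalHom_uO, smul_eq_mul]

theorem eq_zero_of_evalBar_eq_zero {x : PolObar N} (h : ∀ g : O N, evalBar g x = 0) : x = 0 := by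
  refine (LinearEquiv.map_eq_zero_iff (theta N).symm).1 (PolO.ext fun g => ?_)
  rw [map_zero]
  exact h g

theorem eq_zero_of_forall_mul'_map_eq_zero {K V W X Y : Type*} [Field K] [AddCommMonoid V]
    [AddCommMonoid W] [Module K V] [Module K W] [Module.Free K W] {f : X → V →ₗ[K] K}
    {f' : Y → W →ₗ[K] K} (hf : ∀ v, (∀ x, f x v = 0) → v = 0) (hf' : ∀ w, (∀ y, f' y w = 0) → w = 0)
    {z : V ⊗[K] W} (hz : ∀ x y, LinearMap.mul' K K (TensorProduct.map (f x) (f' y) z) = 0) :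
    z = 0 := by
  let b := Module.Free.chooseBasis K W
  have hmul' : ∀ x y, f' y (TensorProduct.lid K W ((f x).rTensor W z)) =
      LinearMap.mul' K K (TensorProduct.map (f x) (f' y) z) := fun x y => by
    clear hz
    induction z using TensorProduct.induction_on with
    | zero => simp only [map_zero]
    | tmul v w => simp
    | add z z' h h' => simp only [map_add, h, h']
  have hcoord : ∀ x i, f x (TensorProduct.equivFinsuppOfBasisRight b z i) =
      b.repr (TensorProduct.lid K W ((f x).rTensor W z)) i := fun x i => by
    clear hz hmul'
    induction z using TensorProduct.induction_on with
    | zero => simp only [map_zero, Finsupp.zero_apply]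
    | tmul v w => simp [mul_comm]
    | add z z' h h' => simp only [map_add, Finsupp.add_apply, h, h']
  refine (LinearEquiv.map_eq_zero_iff (TensorProduct.equivFinsuppOfBasisRight b)).1 ?_
  ext i
  refine hf _ fun x => ?_
  have hcontract : TensorProduct.lid K W ((f x).rTensor W z) = 0 :=
    hf' _ fun y => (hmul' x y).trans (hz x y)
  rw [hcoord, hcontract, map_zero, Finsupp.zero_apply]

/-- The linear form on `O(Ō_N) ⊗ O(Ō_N)` which corresponds under `θ ⊗ θ` to the evaluation at a
point of `O_N × O_N`. -/
def evalBar₂ (g h : O N) : PolObar N ⊗[ℂ] PolObar N →ₗ[ℂ] ℂ :=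
  LinearMap.mul' ℂ ℂ ∘ₗ TensorProduct.map (evalBar g) (evalBar h)

theorem evalBar₂_tmul (g h : O N) (x y : PolObar N) :
    evalBar₂ g h (x ⊗ₜ y) = evalBar g x * evalBar h y := rfl

theorem eq_zero_of_evalBar₂_eq_zero {z : PolObar N ⊗[ℂ] PolObar N}
    (h : ∀ g h : O N, evalBar₂ g h z = 0) : z = 0 := by
  have : Module.Free ℂ (PolObar N) := Module.Free.of_divisionRing ℂ _
  exact eq_zero_of_forall_mul'_map_eq_zero (fun _ => eq_zero_of_evalBar_eq_zero)
    (fun _ => eq_zero_of_evalBar_eq_zero) h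

theorem ext_evalBar₂ {z z' : PolObar N ⊗[ℂ] PolObar N}
    (h : ∀ g h : O N, evalBar₂ g h z = evalBar₂ g h z') : z = z' :=
  sub_eq_zero.1 (eq_zero_of_evalBar₂_eq_zero fun g g' => by rw [map_sub, h, sub_self])

theorem list_prod_ofFn_sum {A κ : Type*} [Semiring A] [Fintype κ] {m : ℕ} (f : Fin m → κ → A) :
    (List.ofFn fun t => ∑ k, f t k).prod =
      ∑ k : Fin m → κ, (List.ofFn fun t => f t (k t)).prod := by
  classical
  simpa only [MultilinearMap.mkPiAlgebraFin_apply] using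
    (MultilinearMap.mkPiAlgebraFin ℕ m A).map_sum f

theorem list_prod_ofFn_tmul {R A B : Type*} [CommSemiring R] [Semiring A] [Algebra R A]
    [Semiring B] [Algebra R B] {m : ℕ} (x : Fin m → A) (y : Fin m → B) :
    (List.ofFn fun t => x t ⊗ₜ[R] y t).prod = (List.ofFn x).prod ⊗ₜ[R] (List.ofFn y).prod := by
  induction m with
  | zero => rfl
  | succ m ih => simp only [List.ofFn_succ, List.prod_cons, ih, Algebra.TensorProduct.tmul_mul_tmul]

/-- The word with given row and column indices. -/
def word {m : ℕ} (i j : Fin m → Fin N) : List (Fin N × Fin N) := List.ofFn fun t => (i t, j t)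

theorem exists_eq_word (l : List (Fin N × Fin N)) :
    ∃ (m : ℕ) (i j : Fin m → Fin N), l = word i j :=
  ⟨l.length, fun t => (l.get t).1, fun t => (l.get t).2, (List.ofFn_get l).symm⟩

theorem wordProd_word {m : ℕ} {B : Type*} [Monoid B] (x : Matrix (Fin N) (Fin N) B)
    (i j : Fin m → Fin N) : wordProd x (word i j) = (List.ofFn fun t => x (i t) (j t)).prod := by
  rw [wordProd, word, List.map_ofFn]
  rfl

theorem wordProd_word_eq_prod {m : ℕ} {B : Type*} [CommMonoid B] (x : Matrix (Fin N) (Fin N) B)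
    (i j : Fin m → Fin N) : wordProd x (word i j) = ∏ t, x (i t) (j t) := by
  rw [wordProd_word, List.prod_ofFn]

theorem wordSign_word {m : ℕ} (i j : Fin m → Fin N) :
    wordSign (word i j) = listSign (List.ofFn i) * listSign (List.ofFn j) := by
  rw [wordSign, word, List.map_ofFn, List.map_ofFn]
  rfl

/-- The matrix with entries `Δ(ū_{ij}) = ∑ₖ ū_{ik} ⊗ ū_{kj}`. -/
def comulMat (N : ℕ) : Matrix (Fin N) (Fin N) (PolObar N ⊗[ℂ] PolObar N) :=
  Matrix.of fun i j => ∑ k, ubar N i k ⊗ₜ[ℂ] ubar N k j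

theorem wordProd_comulMat {m : ℕ} (i j : Fin m → Fin N) : wordProd (comulMat N) (word i j) =
    ∑ k : Fin m → Fin N, wordProd (ubar N) (word i k) ⊗ₜ[ℂ] wordProd (ubar N) (word k j) := by
  simp only [wordProd_word, ← list_prod_ofFn_tmul]
  exact list_prod_ofFn_sum fun t k => ubar N (i t) k ⊗ₜ[ℂ] ubar N k (j t)

theorem evalBar₂_wordProd_comulMat (g h : O N) (l : List (Fin N × Fin N)) :
    evalBar₂ g h (wordProd (comulMat N) l) = evalBar (g * h) (wordProd (ubar N) l) := by
  obtain ⟨m, i, j, rfl⟩ := exists_eq_word l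
  have hterm : ∀ k : Fin m → Fin N,
      evalBar₂ g h (wordProd (ubar N) (word i k) ⊗ₜ[ℂ] wordProd (ubar N) (word k j)) =
      wordSign (word i j) * ∏ t, (((g : Matrix (Fin N) (Fin N) ℝ) (i t) (k t) : ℂ) *
        ((h : Matrix (Fin N) (Fin N) ℝ) (k t) (j t) : ℂ)) := fun k => by
    rw [evalBar₂_tmul, evalBar_wordProd, evalBar_wordProd, wordSign_word, wordSign_word,
      wordSign_word, wordProd_word_eq_prod, wordProd_word_eq_prod, Finset.prod_mul_distrib]
    simp only [Matrix.map_apply]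
    linear_combination (listSign (List.ofFn i) * listSign (List.ofFn j) *
      (∏ t, ((g : Matrix (Fin N) (Fin N) ℝ) (i t) (k t) : ℂ)) *
      ∏ t, ((h : Matrix (Fin N) (Fin N) ℝ) (k t) (j t) : ℂ)) * listSign_mul_self (List.ofFn k)
  rw [wordProd_comulMat, map_sum, evalBar_wordProd, wordProd_word_eq_prod]
  simp only [hterm, ← Finset.mul_sum, Matrix.map_apply, Submonoid.coe_mul, Matrix.mul_apply,
    Complex.ofReal_sum, Complex.ofReal_mul, Fintype.prod_sum]

theorem exists_comul (N : ℕ) : ∃ Δ : PolObar N →ₐ[ℂ] PolObar N ⊗[ℂ] PolObar N, IsComul Δ :=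
  exists_algHom_of_linearCombination_wordProd (y := comulMat N) (span_wordProd_ubar N)
    fun c hc => eq_zero_of_evalBar₂_eq_zero fun g h => by
      have hcomp : evalBar₂ g h (Finsupp.linearCombination ℂ (wordProd (comulMat N)) c) =
          evalBar (g * h) (Finsupp.linearCombination ℂ (wordProd (ubar N)) c) := by
        simp only [Finsupp.linearCombination_apply, Finsupp.sum, map_sum, map_smul,
          evalBar₂_wordProd_comulMat]
      rw [hcomp, hc, map_zero]

theorem IsComul.evalBar₂_apply {Δ : PolObar N →ₐ[ℂ] PolObar N ⊗[ℂ] PolObar N} (hΔ : IsComul Δ)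
    (x : PolObar N) (g h : O N) : evalBar₂ g h (Δ x) = evalBar (g * h) x := by
  have hmap : (ubar N).map Δ = comulMat N := Matrix.ext hΔ
  refine LinearMap.congr_fun (f := evalBar₂ g h ∘ₗ Δ.toLinearMap)
    (LinearMap.ext_on_range (span_wordProd_ubar N) fun l => ?_) x
  rw [LinearMap.comp_apply, AlgHom.toLinearMap_apply, map_wordProd, hmap,
    evalBar₂_wordProd_comulMat]

theorem evalBar_one_wordProd (l : List (Fin N × Fin N)) :
    evalBar 1 (wordProd (ubar N) l) = wordProd (1 : Matrix (Fin N) (Fin N) ℂ) l := by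
  have hone : ((1 : O N) : Matrix (Fin N) (Fin N) ℝ).map Complex.ofReal = 1 :=
    Matrix.map_one _ Complex.ofReal_zero Complex.ofReal_one
  rw [evalBar_wordProd, hone]
  by_cases h : ∀ p ∈ l, p.1 = p.2
  · rw [wordSign, List.map_congr_left h, listSign_mul_self, one_mul]
  · push Not at h
    obtain ⟨p, hp, hne⟩ := h
    have hzero : wordProd (1 : Matrix (Fin N) (Fin N) ℂ) l = 0 :=
      List.prod_eq_zero (List.mem_map.2 ⟨p, hp, Matrix.one_apply_ne hne⟩)
    rw [hzero, mul_zero]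

theorem exists_counit (N : ℕ) : ∃ ε : PolObar N →ₐ[ℂ] ℂ, IsCounit ε := by
  refine exists_algHom_of_linearCombination_wordProd (y := 1) (span_wordProd_ubar N) fun c hc => ?_
  have hcomp : Finsupp.linearCombination ℂ (wordProd (1 : Matrix (Fin N) (Fin N) ℂ)) c =
      evalBar 1 (Finsupp.linearCombination ℂ (wordProd (ubar N)) c) := by
    simp only [Finsupp.linearCombination_apply, Finsupp.sum, map_sum, map_smul,
      evalBar_one_wordProd]
  rw [hcomp, hc, map_zero]

theorem IsCounit.apply_eq_evalBar {ε : PolObar N →ₐ[ℂ] ℂ} (hε : IsCounit ε) (x : PolObar N) :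
    ε x = evalBar 1 x := by
  have hmap : (ubar N).map ε = 1 := Matrix.ext hε
  refine LinearMap.congr_fun (f := ε.toLinearMap)
    (LinearMap.ext_on_range (span_wordProd_ubar N) fun l => ?_) x
  rw [AlgHom.toLinearMap_apply, map_wordProd, hmap, evalBar_one_wordProd]

theorem isRep_iff_isCorep {Δ : PolObar N →ₐ[ℂ] PolObar N ⊗[ℂ] PolObar N} (hΔ : IsComul Δ)
    {ε : PolObar N →ₐ[ℂ] ℂ} (hε : IsCounit ε) {n : Type*} [Fintype n] [DecidableEq n]
    (ρ : Matrix n n (PolO N)) : IsRep ρ ↔ IsCorep Δ ε (ρ.map (theta N)) := by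
  have hcomul : ∀ i j (g h : O N),
      evalBar₂ g h (Δ (ρ.map (theta N) i j)) = evalO (ρ i j) (g * h) := fun i j g h => by
    rw [hΔ.evalBar₂_apply, Matrix.map_apply, evalBar_theta, evalHom_apply]
  have hprod : ∀ i j (g h : O N),
      evalBar₂ g h (∑ k, ρ.map (theta N) i k ⊗ₜ[ℂ] ρ.map (theta N) k j) =
        ∑ k, evalO (ρ i k) g * evalO (ρ k j) h := fun i j g h => by
    simp only [map_sum, evalBar₂_tmul, Matrix.map_apply, evalBar_theta, evalHom_apply]
  have hcounit : ∀ i j, ε (ρ.map (theta N) i j) = evalO (ρ i j) 1 := fun i j => by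
    rw [hε.apply_eq_evalBar, Matrix.map_apply, evalBar_theta, evalHom_apply]
  constructor
  · intro hρ
    refine ⟨fun i j => ext_evalBar₂ fun g h => ?_, fun i j => ?_⟩
    · rw [hcomul, hprod, hρ.mul]
    · rw [hcounit, hρ.one]
  · intro hw
    refine ⟨fun g h i j => ?_, fun i j => ?_⟩
    · rw [← hcomul, ← hprod, hw.comul]
    · rw [← hcounit, hw.counit]

/-! ### Tensor products of representations -/

section ScalarMul

variable {A : Type*} [Ring A] [Algebra ℂ A] {n m : Type*} [Fintype n] [Fintype m]

theorem map_algebraMap_mul_apply (E : Matrix n n ℂ) (x : Matrix n n A) (i j : n) :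
    (E.map (algebraMap ℂ A) * x) i j = ∑ p, E i p • x p j := by
  simp only [Matrix.mul_apply, Matrix.map_apply, Algebra.smul_def]

theorem mul_map_algebraMap_apply (E : Matrix n n ℂ) (x : Matrix n n A) (i j : n) :
    (x * E.map (algebraMap ℂ A)) i j = ∑ p, E p j • x i p := by
  simp only [Matrix.mul_apply, Matrix.map_apply, Algebra.smul_def, Algebra.commutes]

/-- The Kronecker product of two matrices with the products of their entries taken by the bilinear
map `β`. -/
def bilinKron {B : Type*} [Ring B] [Algebra ℂ B] (β : A →ₗ[ℂ] A →ₗ[ℂ] B) (x : Matrix n n A)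
    (y : Matrix m m A) : Matrix (n × m) (n × m) B :=
  Matrix.of fun p q => β (x p.1 q.1) (y p.2 q.2)

variable {B : Type*} [Ring B] [Algebra ℂ B] (β : A →ₗ[ℂ] A →ₗ[ℂ] B)

theorem map_kronecker_mul_bilinKron (E : Matrix n n ℂ) (F : Matrix m m ℂ) (x : Matrix n n A)
    (y : Matrix m m A) : (E ⊗ₖ F).map (algebraMap ℂ B) * bilinKron β x y =
      bilinKron β (E.map (algebraMap ℂ A) * x) (F.map (algebraMap ℂ A) * y) := by
  ext p q
  rw [map_algebraMap_mul_apply]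
  simp only [bilinKron, Matrix.of_apply]
  rw [map_algebraMap_mul_apply, map_algebraMap_mul_apply]
  simp only [map_sum, LinearMap.sum_apply, map_smul, LinearMap.smul_apply, Finset.smul_sum]
  rw [Fintype.sum_prod_type, Finset.sum_comm]
  refine Finset.sum_congr rfl fun i _ => Finset.sum_congr rfl fun k _ => ?_
  rw [smul_smul, Matrix.kroneckerMap_apply, mul_comm]

theorem bilinKron_mul_map_kronecker (E : Matrix n n ℂ) (F : Matrix m m ℂ) (x : Matrix n n A)
    (y : Matrix m m A) : bilinKron β x y * (E ⊗ₖ F).map (algebraMap ℂ B) =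
      bilinKron β (x * E.map (algebraMap ℂ A)) (y * F.map (algebraMap ℂ A)) := by
  ext p q
  rw [mul_map_algebraMap_apply]
  simp only [bilinKron, Matrix.of_apply]
  rw [mul_map_algebraMap_apply, mul_map_algebraMap_apply]
  simp only [map_sum, LinearMap.sum_apply, map_smul, LinearMap.smul_apply, Finset.smul_sum]
  rw [Fintype.sum_prod_type, Finset.sum_comm]
  refine Finset.sum_congr rfl fun i _ => Finset.sum_congr rfl fun k _ => ?_
  rw [smul_smul, Matrix.kroneckerMap_apply, mul_comm]

end ScalarMul

theorem signChar_mul_self (S : Finset (Fin N)) (d : Fin N → ℤˣ) :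
    signChar S d * signChar S d = 1 := by
  rw [← signChar_symmDiff, symmDiff_self]
  exact Finset.prod_empty

theorem signDiag_mul (d e : Fin N → ℤˣ) : signDiag (d * e) = signDiag d * signDiag e := by
  apply Subtype.ext
  change Matrix.diagonal _ = Matrix.diagonal _ * Matrix.diagonal _
  rw [Matrix.diagonal_mul_diagonal]
  congr 1
  funext i
  simp

theorem signDiag_one : signDiag (1 : Fin N → ℤˣ) = 1 := by
  apply Subtype.ext
  change Matrix.diagonal _ = (1 : Matrix (Fin N) (Fin N) ℝ)
  rw [← Matrix.diagonal_one]
  congr 1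
  funext i
  simp

theorem sum_signChar_finset (d : Fin N → ℤˣ) :
    ∑ S, signChar S d = if d = 1 then (2 : ℂ) ^ N else 0 := by
  have hfactor : ∑ S, signChar S d = ∏ i, (1 + ((d i : ℤ) : ℂ)) := by
    rw [Finset.prod_one_add, Finset.powerset_univ]
    rfl
  rw [hfactor]
  split_ifs with hd
  · subst hd
    norm_num
  · obtain ⟨i, hi⟩ := Function.ne_iff.1 hd
    refine Finset.prod_eq_zero (Finset.mem_univ i) ?_
    rw [(Int.units_eq_one_or (d i)).resolve_left hi]
    norm_num

section Rep

variable {n m : Type*} [Fintype n] [Fintype m]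

/-- The projection onto the isotypic component of `signChar S` under the diagonal sign matrices. -/
def isotypicProj (ρ : Matrix n n (PolO N)) (S : Finset (Fin N)) : Matrix n n ℂ :=
  ((2 : ℂ) ^ N)⁻¹ • ∑ d, signChar S d • ρ.map (evalHom (signDiag d))

/-- The block of a representation between two isotypic components of the diagonal sign matrices,
whose entries have a bidegree. -/
def isotypicBlock (ρ : Matrix n n (PolO N)) (S T : Finset (Fin N)) :
    Matrix n n (PolO N) :=
  (isotypicProj ρ S).map (algebraMap ℂ (PolO N)) * ρ *
    (isotypicProj ρ T).map (algebraMap ℂ (PolO N))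

theorem map_evalHom_isotypicBlock (ρ : Matrix n n (PolO N)) (S T : Finset (Fin N)) (g : O N) :
    (isotypicBlock ρ S T).map (evalHom g) =
      isotypicProj ρ S * ρ.map (evalHom g) * isotypicProj ρ T := by
  have hconst : ∀ E : Matrix n n ℂ, (E.map (algebraMap ℂ (PolO N))).map (evalHom g) = E :=
    fun E => Matrix.ext fun i j => (evalHom g).commutes (E i j)
  rw [isotypicBlock, Matrix.map_mul, Matrix.map_mul, hconst, hconst]

theorem map_kronecker_mul_mul (β : PolO N →ₗ[ℂ] PolO N →ₗ[ℂ] PolObar N)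
    (ρ : Matrix n n (PolO N)) (τ : Matrix m m (PolO N)) (S T S' T' : Finset (Fin N)) :
    (isotypicProj ρ S ⊗ₖ isotypicProj τ T).map (algebraMap ℂ (PolObar N)) * bilinKron β ρ τ *
      (isotypicProj ρ S' ⊗ₖ isotypicProj τ T').map (algebraMap ℂ (PolObar N)) =
      bilinKron β (isotypicBlock ρ S S') (isotypicBlock τ T T') := by
  rw [map_kronecker_mul_bilinKron, bilinKron_mul_map_kronecker]
  rfl

variable [DecidableEq n] [DecidableEq m]

theorem IsRep.map_mul {ρ : Matrix n n (PolO N)} (hρ : IsRep ρ) (g h : O N) :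
    ρ.map (evalHom (g * h)) = ρ.map (evalHom g) * ρ.map (evalHom h) := by
  ext i j
  rw [Matrix.mul_apply]
  exact hρ.mul g h i j

theorem IsRep.map_one {ρ : Matrix n n (PolO N)} (hρ : IsRep ρ) : ρ.map (evalHom 1) = 1 := by
  ext i j
  rw [Matrix.one_apply]
  exact hρ.one i j

theorem isotypicProj_mul {ρ : Matrix n n (PolO N)} (hρ : IsRep ρ) (S : Finset (Fin N))
    (e : Fin N → ℤˣ) :
    isotypicProj ρ S * ρ.map (evalHom (signDiag e)) = signChar S e • isotypicProj ρ S := by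
  rw [isotypicProj, Matrix.smul_mul, Finset.sum_mul, smul_comm (signChar S e),
    Finset.smul_sum (r := signChar S e)]
  congr 1
  refine Fintype.sum_equiv (Equiv.mulRight e) _ _ fun d => ?_
  rw [Matrix.smul_mul, ← hρ.map_mul, ← signDiag_mul, Equiv.coe_mulRight, smul_smul, signChar_mul]
  congr 1
  linear_combination -signChar S d * signChar_mul_self S e

theorem mul_isotypicProj {ρ : Matrix n n (PolO N)} (hρ : IsRep ρ) (S : Finset (Fin N))
    (e : Fin N → ℤˣ) :
    ρ.map (evalHom (signDiag e)) * isotypicProj ρ S = signChar S e • isotypicProj ρ S := by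
  rw [isotypicProj, Matrix.mul_smul, Finset.mul_sum, smul_comm (signChar S e),
    Finset.smul_sum (r := signChar S e)]
  congr 1
  refine Fintype.sum_equiv (Equiv.mulLeft e) _ _ fun d => ?_
  rw [Matrix.mul_smul, ← hρ.map_mul, ← signDiag_mul, Equiv.coe_mulLeft, smul_smul, signChar_mul]
  congr 1
  linear_combination -signChar S d * signChar_mul_self S e

theorem isotypicProj_mul_isotypicProj {ρ : Matrix n n (PolO N)} (hρ : IsRep ρ)
    (S T : Finset (Fin N)) :
    isotypicProj ρ S * isotypicProj ρ T = if S = T then isotypicProj ρ S else 0 := by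
  conv_lhs => enter [2]; rw [isotypicProj]
  simp only [Matrix.mul_smul, Finset.mul_sum, isotypicProj_mul hρ, smul_smul]
  rw [← Finset.sum_smul, sum_signChar_mul, smul_smul]
  simp only [@eq_comm _ T S]
  split_ifs
  · rw [inv_mul_cancel₀ (pow_ne_zero _ two_ne_zero), one_smul]
  · simp

theorem sum_isotypicProj {ρ : Matrix n n (PolO N)} (hρ : IsRep ρ) : ∑ S, isotypicProj ρ S = 1 := by
  simp only [isotypicProj]
  rw [← Finset.smul_sum, Finset.sum_comm]
  simp only [← Finset.sum_smul, sum_signChar_finset, ite_smul, zero_smul]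
  rw [Finset.sum_ite_eq', if_pos (Finset.mem_univ _), signDiag_one, hρ.map_one, smul_smul,
    inv_mul_cancel₀ (pow_ne_zero _ two_ne_zero), one_smul]

theorem hasBidegree_isotypicBlock {ρ : Matrix n n (PolO N)} (hρ : IsRep ρ) (S T : Finset (Fin N))
    (i j : n) : HasBidegree S T (isotypicBlock ρ S T i j) := by
  intro d e g
  have hmap : (isotypicBlock ρ S T).map (evalHom (signDiag d * g * signDiag e)) =
      (signChar S d * signChar T e) • (isotypicBlock ρ S T).map (evalHom g) := by
    rw [map_evalHom_isotypicBlock, map_evalHom_isotypicBlock, hρ.map_mul, hρ.map_mul]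
    simp only [Matrix.mul_assoc]
    rw [mul_isotypicProj hρ, ← Matrix.mul_assoc, isotypicProj_mul hρ]
    simp only [Matrix.mul_smul, Matrix.smul_mul, smul_smul]
    rw [mul_comm (signChar T e)]
  exact congrFun (congrFun hmap i) j

/-- The multiplication of `PolO N` followed by `theta N`. -/
def thetaMul (N : ℕ) : PolO N →ₗ[ℂ] PolO N →ₗ[ℂ] PolObar N :=
  LinearMap.compr₂ (LinearMap.mul ℂ (PolO N)) (theta N).toLinearMap

/-- The multiplication of `PolObar N` transported by `theta N`, whose comparison with `thetaMul` is
the cocycle identity of the twist. -/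
def mulTheta (N : ℕ) : PolO N →ₗ[ℂ] PolO N →ₗ[ℂ] PolObar N :=
  LinearMap.compl₁₂ (LinearMap.mul ℂ (PolObar N)) (theta N).toLinearMap (theta N).toLinearMap

theorem bilinKron_isotypicBlock {ρ : Matrix n n (PolO N)} {τ : Matrix m m (PolO N)} (hρ : IsRep ρ)
    (hτ : IsRep τ) (S T S' T' : Finset (Fin N)) :
    bilinKron (mulTheta N) (isotypicBlock ρ S T) (isotypicBlock τ S' T') =
      (cocycle S S' * cocycle T T') •
        bilinKron (thetaMul N) (isotypicBlock ρ S T) (isotypicBlock τ S' T') := by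
  refine Matrix.ext fun p q => ?_
  exact (isTwist_theta N).map_mul _ _ _ _ _ _ (hasBidegree_isotypicBlock hρ S T _ _)
    (hasBidegree_isotypicBlock hτ S' T' _ _)

/-- The operator acting by the cocycle on pairs of isotypic components; it intertwines the twist of
`ρ ⊗ τ` with the tensor product of the twists. -/
def intertwiner (ρ : Matrix n n (PolO N)) (τ : Matrix m m (PolO N)) :
    Matrix (n × m) (n × m) ℂ :=
  ∑ S, ∑ T, cocycle S T • (isotypicProj ρ S ⊗ₖ isotypicProj τ T)

theorem intertwiner_mul_kronecker {ρ : Matrix n n (PolO N)} {τ : Matrix m m (PolO N)}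
    (hρ : IsRep ρ) (hτ : IsRep τ) (S T : Finset (Fin N)) :
    intertwiner ρ τ * (isotypicProj ρ S ⊗ₖ isotypicProj τ T) =
      cocycle S T • (isotypicProj ρ S ⊗ₖ isotypicProj τ T) := by
  simp only [intertwiner, Finset.sum_mul, Matrix.smul_mul, ← Matrix.mul_kronecker_mul,
    isotypicProj_mul_isotypicProj hρ, isotypicProj_mul_isotypicProj hτ]
  rw [Finset.sum_eq_single S (fun S' _ h => by simp [h]) (by simp),
    Finset.sum_eq_single T (fun T' _ h => by simp [h]) (by simp), if_pos rfl, if_pos rfl]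

theorem sum_kronecker_isotypicProj {ρ : Matrix n n (PolO N)} {τ : Matrix m m (PolO N)}
    (hρ : IsRep ρ) (hτ : IsRep τ) : ∑ S, ∑ T, isotypicProj ρ S ⊗ₖ isotypicProj τ T = 1 := by
  rw [← Matrix.one_kronecker_one, ← sum_isotypicProj hρ, ← sum_isotypicProj hτ]
  ext p q
  simp only [Matrix.sum_apply, Matrix.kroneckerMap_apply, Finset.sum_mul_sum]

theorem intertwiner_mul_self {ρ : Matrix n n (PolO N)} {τ : Matrix m m (PolO N)} (hρ : IsRep ρ)
    (hτ : IsRep τ) : intertwiner ρ τ * intertwiner ρ τ = 1 := by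
  conv_lhs => enter [2]; rw [intertwiner]
  simp only [Finset.mul_sum, Matrix.mul_smul, intertwiner_mul_kronecker hρ hτ, smul_smul,
    cocycle_mul_self, one_smul]
  exact sum_kronecker_isotypicProj hρ hτ

theorem map_intertwiner {n m : Type*} (ρ : Matrix n n (PolO N)) (τ : Matrix m m (PolO N)) :
    (intertwiner ρ τ).map (algebraMap ℂ (PolObar N)) = ∑ S, ∑ T,
      cocycle S T • (isotypicProj ρ S ⊗ₖ isotypicProj τ T).map (algebraMap ℂ (PolObar N)) := by
  change (Algebra.ofId ℂ (PolObar N)).toLinearMap.mapMatrix (intertwiner ρ τ) = _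
  rw [intertwiner]
  simp only [map_sum, map_smul]
  rfl

theorem sum_map_kronecker {ρ : Matrix n n (PolO N)} {τ : Matrix m m (PolO N)} (hρ : IsRep ρ)
    (hτ : IsRep τ) : ∑ S, ∑ T,
      (isotypicProj ρ S ⊗ₖ isotypicProj τ T).map (algebraMap ℂ (PolObar N)) = 1 := by
  have hmap := congrArg (Algebra.ofId ℂ (PolObar N)).mapMatrix (sum_kronecker_isotypicProj hρ hτ)
  simp only [map_sum, _root_.map_one] at hmap
  exact hmap

theorem corepEquiv_kronecker {ρ : Matrix n n (PolO N)} {τ : Matrix m m (PolO N)} (hρ : IsRep ρ)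
    (hτ : IsRep τ) :
    CorepEquiv ((ρ ⊗ₖ τ).map (theta N)) (ρ.map (theta N) ⊗ₖ τ.map (theta N)) := by
  have hsq := intertwiner_mul_self hρ hτ
  refine ⟨intertwiner ρ τ, ⟨⟨_, _, hsq, hsq⟩, rfl⟩, ?_⟩
  have hthetaMul : (ρ ⊗ₖ τ).map (theta N) = bilinKron (thetaMul N) ρ τ := rfl
  have hmulTheta : ρ.map (theta N) ⊗ₖ τ.map (theta N) = bilinKron (mulTheta N) ρ τ := rfl
  rw [hthetaMul, hmulTheta, ← Matrix.mul_one (_ * bilinKron (thetaMul N) ρ τ),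
    ← Matrix.one_mul (bilinKron (mulTheta N) ρ τ * _),
    ← sum_map_kronecker hρ hτ, map_intertwiner, ← Matrix.mul_assoc]
  simp only [Finset.sum_mul, Finset.mul_sum, Matrix.smul_mul, Matrix.mul_smul,
    map_kronecker_mul_mul, bilinKron_isotypicBlock hρ hτ, smul_smul]
  refine Finset.sum_congr rfl fun S _ => Finset.sum_congr rfl fun T _ =>
    Finset.sum_congr rfl fun S' _ => Finset.sum_congr rfl fun T' _ => ?_
  congr 1
  linear_combination -cocycle S' T' * cocycle_mul_self S T

end Rep

/-! ### The coefficients of the coaction -/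

theorem cubeElt_injective : Function.Injective (cubeElt (N := N)) := by
  intro A B h
  ext a
  have hcoord := congrArg Multiplicative.toAdd (congrFun h a)
  simp only [cubeElt, toAdd_ofAdd] at hcoord
  by_cases hA : a ∈ A <;> by_cases hB : a ∈ B <;> simp_all

theorem cubeElt_symmDiff (A B : Finset (Fin N)) :
    cubeElt (A ∆ B) = cubeElt A * cubeElt B := by
  funext a
  change Multiplicative.ofAdd (if a ∈ A ∆ B then (1 : ZMod 2) else 0) =
    Multiplicative.ofAdd ((if a ∈ A then (1 : ZMod 2) else 0) + if a ∈ B then 1 else 0)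
  by_cases hA : a ∈ A <;> by_cases hB : a ∈ B <;> simp [Finset.mem_symmDiff, hA, hB]
  rfl

theorem cubeElt_parity (l : List (Fin N)) :
    cubeElt (parity l) = (l.map fun a => cubeElt {a}).prod := by
  induction l with
  | nil => rfl
  | cons a l ih => rw [parity, cubeElt_symmDiff, ih, List.map_cons, List.prod_cons]

/-- The coefficient in `PolObar N` of a group element of the cube. -/
def cubeCoeff (c : Cube N) : PolObar N ⊗[ℂ] MonoidAlgebra ℂ (Cube N) →ₗ[ℂ] PolObar N :=
  (TensorProduct.rid ℂ (PolObar N)).toLinearMap ∘ₗ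
    ((Finsupp.lapply c : (Cube N →₀ ℂ) →ₗ[ℂ] ℂ) ∘ₗ
        (MonoidAlgebra.coeffLinearEquiv ℂ).toLinearMap).lTensor (PolObar N)

theorem cubeCoeff_tmul_of (c c' : Cube N) (x : PolObar N) :
    cubeCoeff c (x ⊗ₜ MonoidAlgebra.of ℂ (Cube N) c') = if c' = c then x else 0 := by
  have hsingle : cubeCoeff c (x ⊗ₜ MonoidAlgebra.of ℂ (Cube N) c') =
      (Finsupp.single c' (1 : ℂ) c) • x := rfl
  rw [hsingle, Finsupp.single_apply, ite_smul, one_smul, zero_smul]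

theorem coactCoeff_eq_cubeCoeff (A B : Finset (Fin N)) :
    coactCoeff A B =
      cubeCoeff (cubeElt B) (coaction N (MonoidAlgebra.of ℂ (Cube N) (cubeElt A))) := rfl

theorem coaction_cubeElt_parity (l : List (Fin N)) :
    coaction N (MonoidAlgebra.of ℂ (Cube N) (cubeElt (parity l))) = (l.map (coactGen N)).prod := by
  rw [cubeElt_parity, map_list_prod, map_list_prod, List.map_map, List.map_map]
  congr 1
  exact List.map_congr_left fun a _ => coaction_gen N a

section Minors

variable {r : ℕ}

theorem coactCoeff_parity (f : Fin r → Fin N) (B : Finset (Fin N)) :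
    coactCoeff (parity (List.ofFn f)) B = ∑ k : Fin r → Fin N,
      if parity (List.ofFn k) = B then wordProd (ubar N) (word f k) else 0 := by
  have hexpand := list_prod_ofFn_sum fun (t : Fin r) (b : Fin N) =>
    ubar N (f t) b ⊗ₜ[ℂ] MonoidAlgebra.of ℂ (Cube N) (cubeElt {b})
  have hcube : ∀ k : Fin r → Fin N,
      (List.ofFn fun t => MonoidAlgebra.of ℂ (Cube N) (cubeElt {k t})).prod =
        MonoidAlgebra.of ℂ (Cube N) (cubeElt (parity (List.ofFn k))) := fun k => by
    rw [cubeElt_parity, map_list_prod, List.map_map, List.map_ofFn]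
    rfl
  rw [coactCoeff_eq_cubeCoeff, coaction_cubeElt_parity, List.map_ofFn]
  refine (congrArg _ hexpand).trans ?_
  rw [map_sum]
  refine Finset.sum_congr rfl fun k _ => ?_
  rw [list_prod_ofFn_tmul, hcube, cubeCoeff_tmul_of, wordProd_word]
  exact if_congr cubeElt_injective.eq_iff rfl rfl

theorem wordProd_ubar_eq_theta (l : List (Fin N × Fin N)) :
    wordProd (ubar N) l = theta N (wordSign l • wordProd (uO N) l) := by
  rw [map_smul, theta_wordProd, smul_smul, wordSign_mul_self, one_smul]

/-- The subsets of `Fin N` with `r` elements, indexing the matrices of degree `r`. -/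
abbrev CardSubset (N r : ℕ) : Type := {A : Finset (Fin N) // A.card = r}

/-- The increasing enumeration of a subset with `r` elements. -/
def CardSubset.enum (A : CardSubset N r) : Fin r ↪o Fin N := A.1.orderEmbOfFin A.2

theorem CardSubset.range_enum (A : CardSubset N r) : Set.range A.enum = A.1 :=
  Finset.range_orderEmbOfFin _ _

theorem CardSubset.image_enum (A : CardSubset N r) : Finset.univ.image A.enum = A.1 :=
  Finset.image_orderEmbOfFin_univ _ _

theorem CardSubset.parity_enum_comp_perm (A : CardSubset N r) (σ : Equiv.Perm (Fin r)) :
    parity (List.ofFn fun t => A.enum (σ t)) = A.1 := by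
  rw [parity_ofFn_of_injective (k := fun t => A.enum (σ t)) (A.enum.injective.comp σ.injective),
    ← A.image_enum]
  exact (Finset.image_image (f := σ) (g := A.enum)).symm.trans
    (by rw [Finset.image_univ_of_surjective σ.surjective])

theorem CardSubset.exists_perm_of_parity_eq (B : CardSubset N r) {k : Fin r → Fin N}
    (hk : Function.Injective k) (hB : parity (List.ofFn k) = B.1) :
    ∃ σ : Equiv.Perm (Fin r), (fun t => B.enum (σ t)) = k := by
  have hmem : ∀ t, ∃ s, B.enum s = k t := fun t => by
    rw [← Set.mem_range, B.range_enum, ← hB, parity_ofFn_of_injective hk]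
    simp
  choose s hs using hmem
  have hinj : Function.Injective s := fun x y hxy => hk (by rw [← hs, ← hs, hxy])
  exact ⟨Equiv.ofBijective s (Finite.injective_iff_bijective.1 hinj), funext hs⟩

/-- The minors of the matrix of coordinates of `O_N`. -/
def minor (a b : Fin r → Fin N) : PolO N :=
  ((uO N).submatrix a b).det

theorem minor_comp_perm (a b : Fin r → Fin N) (σ : Equiv.Perm (Fin r)) :
    minor a (fun t => b (σ t)) = ((Equiv.Perm.sign σ : ℤ) : ℂ) • minor a b := by
  rw [Algebra.smul_def, map_intCast]
  exact Matrix.det_permute' σ ((uO N).submatrix a b)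

theorem minor_eq_zero (a : Fin r → Fin N) {b : Fin r → Fin N} (hb : ¬Function.Injective b) :
    minor a b = 0 := by
  obtain ⟨s, t, hst, hne⟩ := Function.not_injective_iff.1 hb
  exact Matrix.det_zero_of_column_eq hne fun i => by simp [hst]

theorem minor_eq_sum (a b : Fin r → Fin N) : minor a b =
    ∑ σ : Equiv.Perm (Fin r), ((Equiv.Perm.sign σ : ℤ) : ℂ) •
      wordProd (uO N) (word (fun t => a (σ t)) b) := by
  rw [minor, Matrix.det_apply']
  refine Finset.sum_congr rfl fun σ _ => ?_
  rw [wordProd_word_eq_prod, Algebra.smul_def, map_intCast]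
  rfl

theorem coactCoeff_eq_sum_perm (A : CardSubset N r) (B : Finset (Fin N))
    (σ : Equiv.Perm (Fin r)) : coactCoeff A.1 B =
      theta N (∑ k : Fin r → Fin N, if parity (List.ofFn k) = B then
        listSign (List.ofFn k) • ((Equiv.Perm.sign σ : ℤ) : ℂ) •
          wordProd (uO N) (word (fun t => A.enum (σ t)) k) else 0) := by
  have hcoeff := coactCoeff_parity (fun t => A.enum (σ t)) B
  rw [A.parity_enum_comp_perm σ] at hcoeff
  rw [hcoeff, map_sum]
  refine Finset.sum_congr rfl fun k _ => ?_
  split_ifs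
  · rw [wordProd_ubar_eq_theta, wordSign_word, listSign_ofFn_comp_perm, mul_comm, mul_smul]
  · rw [map_zero]

theorem sum_perm_const {M : Type*} [AddCommGroup M] [Module ℂ M] (r : ℕ) (x : M) :
    ∑ _σ : Equiv.Perm (Fin r), x = (r.factorial : ℂ) • x := by
  rw [Finset.sum_const, Finset.card_univ, Fintype.card_perm, Fintype.card_fin,
    Nat.cast_smul_eq_nsmul]

-- Averaging over the orderings of `A` turns the words into minors, and this removes the terms
-- where `k` is not injective, which do not vanish one by one.
theorem factorial_smul_coactCoeff (A : CardSubset N r) (B : Finset (Fin N)) :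
    (r.factorial : ℂ) • coactCoeff A.1 B =
      theta N (∑ k : Fin r → Fin N, if parity (List.ofFn k) = B then
        listSign (List.ofFn k) • minor A.enum k else 0) := by
  rw [← sum_perm_const, Finset.sum_congr rfl fun σ _ => coactCoeff_eq_sum_perm A B σ, ← map_sum,
    Finset.sum_comm]
  congr 1
  refine Finset.sum_congr rfl fun k _ => ?_
  split_ifs
  · rw [minor_eq_sum, Finset.smul_sum]
  · exact Finset.sum_const_zero

theorem coactCoeff_eq_zero {A B : Finset (Fin N)} (hAB : A.card ≠ B.card) :
    coactCoeff A B = 0 := by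
  have hterm : ∀ k : Fin A.card → Fin N, (if parity (List.ofFn k) = B then
      listSign (List.ofFn k) • minor (CardSubset.enum ⟨A, rfl⟩) k else 0) = 0 := fun k => by
    refine ite_eq_right_iff.2 fun hB => ?_
    by_cases hk : Function.Injective k
    · rw [parity_ofFn_of_injective hk] at hB
      exact absurd (by rw [← hB, Finset.card_image_of_injective _ hk, Finset.card_univ,
        Fintype.card_fin]) hAB
    · rw [minor_eq_zero _ hk, smul_zero]
  have hfactorial := factorial_smul_coactCoeff ⟨A, rfl⟩ B
  rw [Finset.sum_eq_zero fun k _ => hterm k, map_zero] at hfactorial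
  exact (smul_eq_zero.1 hfactorial).resolve_left (Nat.cast_ne_zero.2 (Nat.factorial_ne_zero _))

theorem sum_listSign_smul_minor (A B : CardSubset N r) :
    (∑ k : Fin r → Fin N, if parity (List.ofFn k) = B.1 then
      listSign (List.ofFn k) • minor A.enum k else 0) =
      (r.factorial : ℂ) • minor A.enum B.enum := by
  rw [← sum_perm_const r (minor A.enum B.enum)]
  symm
  refine Fintype.sum_of_injective (fun (σ : Equiv.Perm (Fin r)) t => B.enum (σ t))
    (fun σ τ h => Equiv.ext fun t => B.enum.injective (congrFun h t)) _ _ (fun k hk => ?_)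
    (fun σ => ?_)
  · refine ite_eq_right_iff.2 fun hB => ?_
    by_cases hinj : Function.Injective k
    · exact absurd (B.exists_perm_of_parity_eq hinj hB) hk
    · rw [minor_eq_zero _ hinj, smul_zero]
  · rw [if_pos (B.parity_enum_comp_perm σ), listSign_ofFn_comp_perm, minor_comp_perm, smul_smul,
      intUnit_mul_self, one_smul]

theorem coactCoeff_eq_theta_minor (A B : CardSubset N r) :
    coactCoeff A.1 B.1 = theta N (minor A.enum B.enum) := by
  have hfactorial := factorial_smul_coactCoeff A B.1
  rw [sum_listSign_smul_minor, map_smul] at hfactorial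
  exact smul_right_injective _ (Nat.cast_ne_zero.2 (Nat.factorial_ne_zero r)) hfactorial

end Minors

/-! ### The antisymmetric representations -/

section Antisymmetric

variable {r : ℕ}

/-- The coefficient of the basis tensor `e_{a 0} ⊗ ⋯ ⊗ e_{a (r - 1)}`. -/
def tensorCoeff (a : Fin r → Fin N) : TensorPow N r →ₗ[ℂ] ℂ :=
  PiTensorProduct.lift ((MultilinearMap.mkPiAlgebra ℂ (Fin r) ℂ).compLinearMap
    fun t => (LinearMap.proj (a t) : (Fin N → ℂ) →ₗ[ℂ] ℂ))

theorem tensorCoeff_tprod (a : Fin r → Fin N) (v : Fin r → Fin N → ℂ) :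
    tensorCoeff a (PiTensorProduct.tprod ℂ v) = ∏ t, v t (a t) := by
  rw [tensorCoeff, PiTensorProduct.lift.tprod]
  rfl

theorem tensorCoeff_alt (a : Fin r → Fin N) (v : Fin r → Fin N → ℂ) :
    tensorCoeff a (alt N r v) = (Matrix.of fun s t => v s (a t)).det := by
  rw [alt_apply, map_sum, Matrix.det_apply']
  refine Finset.sum_congr rfl fun σ _ => ?_
  rw [map_smul, tensorCoeff_tprod]
  rfl

theorem CardSubset.exists_enum_not_mem {A B : CardSubset N r} (hAB : A ≠ B) :
    ∃ s, B.enum s ∉ A.1 := by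
  by_contra! hmem
  have hsub : B.1 ⊆ A.1 := by
    rw [← B.image_enum]
    exact Finset.image_subset_iff.2 fun s _ => hmem s
  exact hAB (Subtype.ext (Finset.eq_of_subset_of_card_le hsub (by rw [A.2, B.2])).symm)

theorem CardSubset.enum_mem (A : CardSubset N r) (s : Fin r) : A.enum s ∈ A.1 :=
  Finset.orderEmbOfFin_mem _ _ _

theorem CardSubset.exists_enum_eq (i : Fin r ↪o Fin N) : ∃ A : CardSubset N r, A.enum = i := by
  have hcard : (Finset.univ.image i).card = r := by
    rw [Finset.card_image_of_injective _ i.injective, Finset.card_univ, Fintype.card_fin]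
  refine ⟨⟨Finset.univ.image i, hcard⟩, DFunLike.ext' ?_⟩
  exact (Finset.orderEmbOfFin_unique hcard
    (fun t => Finset.mem_image_of_mem _ (Finset.mem_univ t)) i.strictMono).symm

theorem tensorCoeff_xi (A B : CardSubset N r) :
    tensorCoeff A.enum (xi B.enum) = if A = B then 1 else 0 := by
  rw [xi_eq_alt, tensorCoeff_alt]
  split_ifs with hAB
  · subst hAB
    have hone : (Matrix.of fun s t => (Pi.single (A.enum s) 1 : Fin N → ℂ) (A.enum t)) = 1 := by
      ext s t
      rw [Matrix.of_apply, Pi.single_apply, Matrix.one_apply]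
      exact if_congr (by rw [A.enum.injective.eq_iff, eq_comm]) rfl rfl
    rw [hone, Matrix.det_one]
  · obtain ⟨s, hs⟩ := CardSubset.exists_enum_not_mem hAB
    refine Matrix.det_eq_zero_of_row_eq_zero s fun t => ?_
    rw [Matrix.of_apply, Pi.single_apply, if_neg]
    exact fun h => hs (h ▸ A.enum_mem t)

/-- The vector `ξ_{i_1 … i_r}` of `antisym N r` for `A = {i_1 < ⋯ < i_r}`. -/
def xiVec (A : CardSubset N r) : antisym N r := ⟨xi A.enum, xi_mem _⟩

theorem linearIndependent_xiVec (N r : ℕ) : LinearIndependent ℂ (xiVec (N := N) (r := r)) := by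
  rw [Fintype.linearIndependent_iffₛ]
  intro c c' hc A
  have hcoeff := congrArg (fun x : antisym N r => tensorCoeff A.enum (x : TensorPow N r)) hc
  simp only [AddSubmonoidClass.coe_finsetSum, Submodule.coe_smul, map_sum, map_smul] at hcoeff
  have hxi : ∀ B : CardSubset N r, tensorCoeff A.enum (xiVec B : TensorPow N r) =
      if A = B then 1 else 0 := tensorCoeff_xi A
  simpa [hxi] using hcoeff

theorem span_xiVec (N r : ℕ) : Submodule.span ℂ (Set.range (xiVec (N := N) (r := r))) = ⊤ := by
  have hrange : Set.range (fun i : Fin r ↪o Fin N => xi i) =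
      Set.range ((antisym N r).subtype ∘ xiVec) := by
    refine Set.Subset.antisymm ?_ (Set.range_subset_iff.2 fun A => ⟨A.enum, rfl⟩)
    rintro _ ⟨i, rfl⟩
    obtain ⟨A, rfl⟩ := CardSubset.exists_enum_eq i
    exact ⟨A, rfl⟩
  refine Submodule.map_injective_of_injective (antisym N r).injective_subtype ?_
  rw [Submodule.map_span, Submodule.map_top, Submodule.range_subtype, ← Set.range_comp, ← hrange]
  rfl

/-- The basis of `antisym N r` formed by the vectors `ξ_{i_1 … i_r}`. -/
def xiBasis (N r : ℕ) : Module.Basis (CardSubset N r) ℂ (antisym N r) :=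
  Module.Basis.mk (linearIndependent_xiVec N r) (span_xiVec N r).ge

theorem xiBasis_apply (A : CardSubset N r) : xiBasis N r A = xiVec A :=
  Module.Basis.mk_apply _ _ _

theorem xiBasis_repr (x : antisym N r) (A : CardSubset N r) :
    (xiBasis N r).repr x A = tensorCoeff A.enum (x : TensorPow N r) := by
  have hcoord : (xiBasis N r).coord A = tensorCoeff A.enum ∘ₗ (antisym N r).subtype := by
    refine (xiBasis N r).ext fun B => ?_
    rw [Module.Basis.coord_apply, Module.Basis.repr_self, xiBasis_apply, Finsupp.single_apply]
    exact (if_congr eq_comm rfl rfl).trans (tensorCoeff_xi A B).symm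
  exact LinearMap.congr_fun hcoord x

theorem tensorRep_xi (g : O N) (i : Fin r → Fin N) :
    tensorRep N r g (xi i) = alt N r fun k => stdAct g (Pi.single (i k) 1) := by
  rw [alt_apply, xi, map_sum]
  refine Finset.sum_congr rfl fun σ _ => ?_
  rw [map_smul]
  congr 1
  exact PiTensorProduct.map_tprod _ _

theorem evalHom_minor (g : O N) (a b : Fin r → Fin N) : evalHom g (minor a b) =
    (((g : Matrix (Fin N) (Fin N) ℝ).map Complex.ofReal).submatrix a b).det := by
  have hmap := (evalHom g).map_det ((uO N).submatrix a b)
  rwa [AlgHom.mapMatrix_apply, ← Matrix.submatrix_map, map_evalHom_uO] at hmap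

theorem toMatrix_antisymRep (g : O N) (A B : CardSubset N r) :
    LinearMap.toMatrix (xiBasis N r) (xiBasis N r) (antisymRep N r g) A B =
      evalO (minor A.enum B.enum) g := by
  have hact : ((antisymRep N r g (xiVec B) : antisym N r) : TensorPow N r) =
      tensorRep N r g (xi B.enum) := rfl
  rw [LinearMap.toMatrix_apply, xiBasis_repr, xiBasis_apply, hact, tensorRep_xi, tensorCoeff_alt,
    ← evalHom_apply, evalHom_minor, ← Matrix.det_transpose]
  congr 1
  ext s t
  simp [stdAct, Matrix.toLin'_apply]

theorem corresponds_antisymRep (N r : ℕ) :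
    Corresponds (theta N) (antisymRep N r) (magicComponent N r) :=
  ⟨xiBasis N r, Matrix.of fun A B : CardSubset N r => minor A.enum B.enum, toMatrix_antisymRep,
    Matrix.ext fun A B => (coactCoeff_eq_theta_minor A B).symm⟩

end Antisymmetric

theorem isRep_of_toMatrix {V : Type*} [AddCommMonoid V] [Module ℂ V]
    {ρ : Representation ℂ (O N) V} {n : Type*} [Fintype n] [DecidableEq n]
    {b : Module.Basis n ℂ V} {c : Matrix n n (PolO N)}
    (h : ∀ g i j, LinearMap.toMatrix b b (ρ g) i j = evalO (c i j) g) : IsRep c where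
  mul g g' i j := by
    simp only [← h]
    rw [map_mul, Module.End.mul_eq_comp, LinearMap.toMatrix_comp b b b, Matrix.mul_apply]
  one i j := by
    rw [← h, map_one, LinearMap.toMatrix_one, Matrix.one_apply]

theorem Corresponds.isCorep {Δ : PolObar N →ₐ[ℂ] PolObar N ⊗[ℂ] PolObar N} (hΔ : IsComul Δ)
    {ε : PolObar N →ₐ[ℂ] ℂ} (hε : IsCounit ε) {V : Type*} [AddCommMonoid V] [Module ℂ V]
    {ρ : Representation ℂ (O N) V} {n : Type*} [Fintype n] [DecidableEq n]
    {w : Matrix n n (PolObar N)} (h : Corresponds (theta N) ρ w) : IsCorep Δ ε w := by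
  obtain ⟨b, c, hc, rfl⟩ := h
  exact (isRep_iff_isCorep hΔ hε c).1 (isRep_of_toMatrix hc)

/-- The basis of `⨁ r, antisym N r` formed by the bases of the summands. -/
def fullBasis (N : ℕ) : Module.Basis (Σ r : Fin (N + 1), CardSubset N (r : ℕ)) ℂ
    (⨁ r : Fin (N + 1), antisym N (r : ℕ)) :=
  DFinsupp.basis fun r : Fin (N + 1) => xiBasis N (r : ℕ)

theorem fullBasis_repr (x : ⨁ r : Fin (N + 1), antisym N (r : ℕ))
    (p : Σ r : Fin (N + 1), CardSubset N (r : ℕ)) :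
    (fullBasis N).repr x p = (xiBasis N p.1).repr (x p.1) p.2 := rfl

theorem fullBasis_apply (p : Σ r : Fin (N + 1), CardSubset N (r : ℕ)) :
    fullBasis N p = DirectSum.lof ℂ (Fin (N + 1)) (fun r => antisym N (r : ℕ)) p.1
      (xiBasis N p.1 p.2) := by
  apply (fullBasis N).repr.injective
  ext q
  rw [Module.Basis.repr_self, fullBasis_repr]
  obtain ⟨r, A⟩ := p
  obtain ⟨s, B⟩ := q
  by_cases hrs : r = s
  · subst hrs
    rw [DirectSum.lof_apply, Module.Basis.repr_self, Finsupp.single_apply, Finsupp.single_apply]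
    exact if_congr (by simp) rfl rfl
  · rw [Finsupp.single_apply, if_neg fun h => hrs (congrArg Sigma.fst h), DirectSum.lof_eq_of,
      DirectSum.of_eq_of_ne _ _ _ (Ne.symm hrs)]
    simp

theorem toMatrix_fullAntisymRep (g : O N) (p q : Σ r : Fin (N + 1), CardSubset N (r : ℕ)) :
    LinearMap.toMatrix (fullBasis N) (fullBasis N) (fullAntisymRep N g) p q =
      evalO ((theta N).symm (coactCoeff p.2.1 q.2.1)) g := by
  have hact : fullAntisymRep N g (DirectSum.lof ℂ (Fin (N + 1)) (fun r => antisym N (r : ℕ)) q.1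
      (xiBasis N q.1 q.2)) = DirectSum.lof ℂ (Fin (N + 1)) (fun r => antisym N (r : ℕ)) q.1
      (antisymRep N q.1 g (xiBasis N q.1 q.2)) := DirectSum.lmap_lof _ _ _
  rw [LinearMap.toMatrix_apply, fullBasis_repr, fullBasis_apply, hact]
  obtain ⟨r, A⟩ := p
  obtain ⟨s, B⟩ := q
  by_cases hrs : r = s
  · subst hrs
    rw [DirectSum.lof_apply, ← LinearMap.toMatrix_apply, toMatrix_antisymRep,
      coactCoeff_eq_theta_minor A B, LinearEquiv.symm_apply_apply]
  · rw [coactCoeff_eq_zero (by rw [A.2, B.2]; exact fun h => hrs (Fin.ext h)), map_zero,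
      DirectSum.lof_eq_of, DirectSum.of_eq_of_ne _ _ _ hrs]
    simp [evalO]

/-! ### The magic representation -/

/-- The identification of the subsets of `Fin N` with the elements `g_A` of the cube. -/
def cubeEquiv (N : ℕ) : Finset (Fin N) ≃ Cube N :=
  Equiv.ofBijective cubeElt ((Fintype.bijective_iff_injective_and_card _).2
    ⟨cubeElt_injective, by simp [Cube]⟩)

theorem exists_eq_cubeElt (j : Cube N) : ∃ A, cubeElt A = j := (cubeEquiv N).surjective j

/-- The disjoint union of the sets `CardSubset N r` is the set of all subsets of `Fin N`. -/
def sigmaCardSubsetEquiv (N : ℕ) :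
    (Σ r : Fin (N + 1), CardSubset N (r : ℕ)) ≃ Finset (Fin N) where
  toFun p := p.2.1
  invFun A := ⟨⟨A.card, Nat.lt_succ_of_le (by simpa using A.card_le_univ)⟩, A, rfl⟩
  left_inv := by
    rintro ⟨⟨r, hr⟩, A, hA⟩
    dsimp at hA
    subst hA
    rfl
  right_inv _ := rfl

/-- The basis of the full antisymmetric representation, indexed by the cube. -/
def cubeBasis (N : ℕ) : Module.Basis (Cube N) ℂ (⨁ r : Fin (N + 1), antisym N (r : ℕ)) :=
  (fullBasis N).reindex ((sigmaCardSubsetEquiv N).trans (cubeEquiv N))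

/-- The coefficients of the coaction, indexed by the cube. -/
def cubeMat (N : ℕ) : Matrix (Cube N) (Cube N) (PolObar N) :=
  Matrix.of fun j l => cubeCoeff l (coaction N (MonoidAlgebra.of ℂ (Cube N) j))

theorem toMatrix_cubeBasis (g : O N) (j l : Cube N) :
    LinearMap.toMatrix (cubeBasis N) (cubeBasis N) (fullAntisymRep N g) j l =
      evalO ((theta N).symm (cubeMat N j l)) g := by
  obtain ⟨p, rfl⟩ := ((sigmaCardSubsetEquiv N).trans (cubeEquiv N)).surjective j
  obtain ⟨q, rfl⟩ := ((sigmaCardSubsetEquiv N).trans (cubeEquiv N)).surjective l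
  rw [LinearMap.toMatrix_apply, cubeBasis, Module.Basis.repr_reindex_apply,
    Module.Basis.reindex_apply, ← LinearMap.toMatrix_apply, toMatrix_fullAntisymRep,
    Equiv.symm_apply_apply, Equiv.symm_apply_apply]
  rfl

theorem cubeMat_one (j : Cube N) : cubeMat N j 1 = if j = 1 then 1 else 0 := by
  split_ifs with hj
  · rw [hj, cubeMat, Matrix.of_apply, map_one, map_one]
    exact (cubeCoeff_tmul_of 1 1 1).trans (if_pos rfl)
  · obtain ⟨A, rfl⟩ := exists_eq_cubeElt j
    have hA : A ≠ ∅ := fun hA => hj (by rw [hA]; rfl)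
    exact coactCoeff_eq_zero (A := A) (B := ∅) (by rwa [Finset.card_empty, Finset.card_ne_zero,
      Finset.nonempty_iff_ne_empty])

theorem pairing_eq_prod (i j : Cube N) : pairing i j = ∏ k,
    (-1 : ℂ) ^ ((Multiplicative.toAdd (i k)).val * (Multiplicative.toAdd (j k)).val) := by
  rw [pairing, Finset.prod_pow_eq_pow_sum]

theorem neg_one_pow_val_add (x y z : ZMod 2) :
    (-1 : ℂ) ^ ((x + y).val * z.val) = (-1) ^ (x.val * z.val) * (-1) ^ (y.val * z.val) := by
  have hcases : ∀ w : ZMod 2, w = 0 ∨ w = 1 := by decide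
  have htwo : (1 + 1 : ZMod 2) = 0 := rfl
  rcases hcases x with rfl | rfl <;> rcases hcases y with rfl | rfl <;>
    simp [htwo, ZMod.val_one, ← mul_pow]

theorem sum_neg_one_pow_val (x z : ZMod 2) :
    ∑ y : ZMod 2, (-1 : ℂ) ^ (x.val * y.val) * (-1) ^ (y.val * z.val) =
      if x = z then 2 else 0 := by
  rw [show (Finset.univ : Finset (ZMod 2)) = {0, 1} from rfl, Finset.sum_pair (by decide)]
  have hcases : ∀ w : ZMod 2, w = 0 ∨ w = 1 := by decide
  rcases hcases x with rfl | rfl <;> rcases hcases z with rfl | rfl <;> norm_num [ZMod.val_one]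

theorem pairing_mul (i j k : Cube N) : pairing (i * j) k = pairing i k * pairing j k := by
  simp only [pairing_eq_prod, ← Finset.prod_mul_distrib]
  exact Finset.prod_congr rfl fun a _ => neg_one_pow_val_add _ _ _

theorem pairing_comm (i j : Cube N) : pairing i j = pairing j i := by
  simp only [pairing_eq_prod, mul_comm]

theorem pairing_one (k : Cube N) : pairing 1 k = 1 := by
  simp [pairing]

theorem pairing_mul_self (i j : Cube N) : pairing i j * pairing i j = 1 := by
  rw [pairing, ← mul_pow, neg_one_mul, neg_neg, one_pow]

theorem star_pairing (i j : Cube N) : star (pairing i j) = pairing i j := by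
  simp [pairing]

theorem sum_pairing_mul (i k : Cube N) :
    ∑ j, pairing i j * pairing j k = if i = k then (2 : ℂ) ^ N else 0 := by
  have hfactor : ∑ j, pairing i j * pairing j k = ∏ a, if i a = k a then (2 : ℂ) else 0 := by
    simp only [pairing_eq_prod, ← Finset.prod_mul_distrib]
    rw [← Fintype.prod_sum fun (a : Fin N) (y : Multiplicative (ZMod 2)) =>
      (-1 : ℂ) ^ ((Multiplicative.toAdd (i a)).val * (Multiplicative.toAdd y).val) *
      (-1) ^ ((Multiplicative.toAdd y).val * (Multiplicative.toAdd (k a)).val)]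
    exact Finset.prod_congr rfl fun a _ => sum_neg_one_pow_val _ _
  rw [hfactor]
  split_ifs with hik
  · simp [hik]
  · obtain ⟨a, ha⟩ := Function.ne_iff.1 hik
    exact Finset.prod_eq_zero (Finset.mem_univ a) (if_neg ha)

theorem sum_pairing (j : Cube N) : ∑ i, pairing i j = if j = 1 then (2 : ℂ) ^ N else 0 := by
  have hsum := sum_pairing_mul 1 j
  simpa only [pairing_one, one_mul, @eq_comm _ (1 : Cube N)] using hsum

/-- The character of the group algebra of the cube given by a vertex. -/
def cubeChar (k : Cube N) : MonoidAlgebra ℂ (Cube N) →ₐ[ℂ] ℂ :=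
  MonoidAlgebra.lift ℂ ℂ (Cube N)
    { toFun := fun i => pairing i k
      map_one' := pairing_one k
      map_mul' := fun i j => pairing_mul i j k }

theorem cubeChar_of (i k : Cube N) :
    cubeChar k (MonoidAlgebra.of ℂ (Cube N) i) = pairing i k := by
  rw [cubeChar, MonoidAlgebra.lift_of]
  rfl

/-- The evaluation at a vertex of the cube, as a morphism from the target of the coaction. -/
def vertexEval (k : Cube N) :
    PolObar N ⊗[ℂ] MonoidAlgebra ℂ (Cube N) →ₐ[ℂ] PolObar N :=
  (Algebra.TensorProduct.rid ℂ ℂ (PolObar N)).toAlgHom.comp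
    (Algebra.TensorProduct.map (AlgHom.id ℂ (PolObar N)) (cubeChar k))

theorem vertexEval_tmul (k : Cube N) (x : PolObar N) (y : MonoidAlgebra ℂ (Cube N)) :
    vertexEval k (x ⊗ₜ y) = cubeChar k y • x := rfl

theorem fourierInv_apply_eq_cubeChar (k : Cube N) (y : MonoidAlgebra ℂ (Cube N)) :
    fourierInv N y k = cubeChar k y := by
  have hlin : (LinearMap.proj k : (Cube N → ℂ) →ₗ[ℂ] ℂ) ∘ₗ fourierInv N =
      (cubeChar k).toLinearMap := by
    ext i
    change ∑ j, (Finsupp.single i (1 : ℂ)) j * pairing j k =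
      cubeChar k (MonoidAlgebra.of ℂ (Cube N) i)
    rw [cubeChar_of]
    simp [Finsupp.single_apply]
  exact LinearMap.congr_fun hlin y

theorem magic_eq_vertexEval (i k : Cube N) :
    magic N i k = vertexEval k (coaction N (fourier N (Pi.single i 1))) := by
  have hcomp : ∀ z : PolObar N ⊗[ℂ] MonoidAlgebra ℂ (Cube N),
      TensorProduct.rid ℂ (PolObar N) ((LinearMap.proj k : (Cube N → ℂ) →ₗ[ℂ] ℂ).lTensor
        (PolObar N) ((fourierInv N).lTensor (PolObar N) z)) = vertexEval k z := fun z => by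
    induction z using TensorProduct.induction_on with
    | zero => simp only [map_zero]
    | tmul x y =>
      rw [vertexEval_tmul, ← fourierInv_apply_eq_cubeChar]
      rfl
    | add z z' hz hz' => simp only [map_add, hz, hz']
  exact hcomp _

theorem fourier_single (i : Cube N) : fourier N (Pi.single i 1) =
    ((2 : ℂ) ^ N)⁻¹ • ∑ j, pairing i j • MonoidAlgebra.of ℂ (Cube N) j := by
  change ∑ i', ∑ j, ((Pi.single i 1 : Cube N → ℂ) i' * ((2 : ℂ) ^ N)⁻¹ * pairing i' j) •
    MonoidAlgebra.of ℂ (Cube N) j = _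
  rw [Finset.sum_eq_single i (fun i' _ h => by simp [h]) (by simp), Finset.smul_sum]
  refine Finset.sum_congr rfl fun j _ => ?_
  rw [Pi.single_eq_same, one_mul, mul_smul]

theorem fourier_single_mul_of (i j : Cube N) :
    fourier N (Pi.single i 1) * MonoidAlgebra.of ℂ (Cube N) j =
      pairing i j • fourier N (Pi.single i 1) := by
  rw [fourier_single, smul_mul_assoc, Finset.sum_mul, smul_comm (pairing i j),
    Finset.smul_sum (r := pairing i j)]
  congr 1
  refine Fintype.sum_equiv (Equiv.mulRight j) _ _ fun l => ?_
  rw [smul_mul_assoc, ← map_mul, Equiv.coe_mulRight, smul_smul, pairing_comm i (l * j),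
    pairing_mul, pairing_comm l, pairing_comm j]
  congr 1
  linear_combination -pairing i l * pairing_mul_self i j

theorem fourier_single_mul_self (i : Cube N) :
    fourier N (Pi.single i 1) * fourier N (Pi.single i 1) = fourier N (Pi.single i 1) := by
  have hcard : (Fintype.card (Cube N) : ℂ) = (2 : ℂ) ^ N := by simp [Cube]
  conv_lhs => enter [2]; rw [fourier_single]
  simp only [mul_smul_comm, Finset.mul_sum, fourier_single_mul_of, smul_smul, pairing_mul_self,
    one_smul]
  rw [Finset.sum_const, Finset.card_univ, ← Nat.cast_smul_eq_nsmul ℂ, smul_smul, hcard,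
    inv_mul_cancel₀ (pow_ne_zero _ two_ne_zero), one_smul]

theorem sum_fourier_single (N : ℕ) : ∑ i : Cube N, fourier N (Pi.single i 1) = 1 := by
  simp only [fourier_single]
  rw [← Finset.smul_sum, Finset.sum_comm]
  simp only [← Finset.sum_smul, sum_pairing, ite_smul, zero_smul]
  rw [Finset.sum_ite_eq', if_pos (Finset.mem_univ _), smul_smul,
    inv_mul_cancel₀ (pow_ne_zero _ two_ne_zero), one_smul, map_one]

theorem magic_eq_sum_vertexEval (i k : Cube N) : magic N i k = ((2 : ℂ) ^ N)⁻¹ •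
    ∑ j, pairing i j • vertexEval k (coaction N (MonoidAlgebra.of ℂ (Cube N) j)) := by
  rw [magic_eq_vertexEval, fourier_single]
  simp only [map_smul, map_sum]

theorem vertexEval_eq_sum (k : Cube N) (z : PolObar N ⊗[ℂ] MonoidAlgebra ℂ (Cube N)) :
    vertexEval k z = ∑ l, pairing l k • cubeCoeff l z := by
  induction z using TensorProduct.induction_on with
  | zero => simp only [map_zero, smul_zero, Finset.sum_const_zero]
  | tmul x y =>
    induction y using MonoidAlgebra.induction_on with
    | of i =>
      rw [vertexEval_tmul, cubeChar_of]
      simp only [cubeCoeff_tmul_of, smul_ite, smul_zero]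
      rw [Finset.sum_ite_eq, if_pos (Finset.mem_univ _)]
    | add y y' hy hy' =>
      simp only [TensorProduct.tmul_add, map_add, hy, hy', smul_add, Finset.sum_add_distrib]
    | smul c y hy =>
      simp only [TensorProduct.tmul_smul, map_smul, hy, Finset.smul_sum]
      exact Finset.sum_congr rfl fun l _ => smul_comm _ _ _
  | add z z' hz hz' => simp only [map_add, hz, hz', smul_add, Finset.sum_add_distrib]

theorem magic_eq_sum_cubeMat (i k : Cube N) : magic N i k =
    ((2 : ℂ) ^ N)⁻¹ • ∑ j, ∑ l, (pairing i j * pairing l k) • cubeMat N j l := by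
  simp only [magic_eq_sum_vertexEval, vertexEval_eq_sum, Finset.smul_sum, smul_smul, cubeMat,
    Matrix.of_apply]

theorem star_vertexEval_coaction (k j : Cube N) :
    star (vertexEval k (coaction N (MonoidAlgebra.of ℂ (Cube N) j))) =
      vertexEval k (coaction N (MonoidAlgebra.of ℂ (Cube N) j)) := by
  have hgen : ∀ a, star (vertexEval k (coaction N (MonoidAlgebra.of ℂ (Cube N) (cubeElt {a})))) =
      vertexEval k (coaction N (MonoidAlgebra.of ℂ (Cube N) (cubeElt {a}))) := fun a => by
    simp only [coaction_gen, map_sum, vertexEval_tmul, cubeChar_of, star_sum, star_smul,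
      star_pairing, (isTwistedOrthogonal_ubar N).selfAdjoint]
  obtain ⟨A, rfl⟩ := exists_eq_cubeElt j
  induction A using Finset.induction_on with
  | empty =>
    have hone : cubeElt (∅ : Finset (Fin N)) = 1 := rfl
    rw [hone, map_one, map_one, map_one, star_one]
  | insert a A ha ih =>
    have hinsert : cubeElt (insert a A) = cubeElt {a} * cubeElt A := by
      rw [← cubeElt_symmDiff, (Finset.disjoint_singleton_left.2 ha).symmDiff_eq_sup]
      rfl
    rw [hinsert, map_mul, map_mul, map_mul, star_mul, ih, hgen, ← map_mul, ← map_mul, mul_comm,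
      map_mul, map_mul]

theorem sum_vertexEval (z : PolObar N ⊗[ℂ] MonoidAlgebra ℂ (Cube N)) :
    ∑ k, vertexEval k z = (2 : ℂ) ^ N • cubeCoeff 1 z := by
  have hpairing : ∀ l : Cube N, ∑ k, pairing l k = if l = 1 then (2 : ℂ) ^ N else 0 := fun l => by
    simpa only [pairing_comm l] using sum_pairing l
  simp only [vertexEval_eq_sum]
  rw [Finset.sum_comm]
  simp only [← Finset.sum_smul, hpairing, ite_smul, zero_smul]
  rw [Finset.sum_ite_eq', if_pos (Finset.mem_univ _)]

theorem sum_magic_row (i : Cube N) : ∑ k, magic N i k = 1 := by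
  simp only [magic_eq_sum_vertexEval]
  rw [← Finset.smul_sum, Finset.sum_comm]
  simp only [← Finset.smul_sum, sum_vertexEval]
  have hcoeff : ∀ j, cubeCoeff 1 (coaction N (MonoidAlgebra.of ℂ (Cube N) j)) =
      if j = 1 then 1 else 0 := cubeMat_one
  simp only [hcoeff, smul_ite, smul_zero]
  rw [Finset.sum_ite_eq', if_pos (Finset.mem_univ _), pairing_comm, pairing_one, one_smul,
    smul_smul, inv_mul_cancel₀ (pow_ne_zero _ two_ne_zero), one_smul]

theorem isMagicUnitary_magic (N : ℕ) : IsMagicUnitary (magic N) where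
  selfAdjoint i k := by
    have hstar : star ((2 : ℂ) ^ N)⁻¹ = ((2 : ℂ) ^ N)⁻¹ := by simp
    simp only [magic_eq_sum_vertexEval, star_smul, star_sum, hstar, star_pairing,
      star_vertexEval_coaction]
  idempotent i k := by
    rw [magic_eq_vertexEval, ← map_mul, ← map_mul, fourier_single_mul_self]
  row_sum := sum_magic_row
  col_sum k := by
    simp only [magic_eq_vertexEval]
    rw [← map_sum, ← map_sum, sum_fourier_single, map_one, map_one]

theorem exists_basis_toMatrix_eq_mul_mul {R M n : Type*} [CommRing R] [AddCommMonoid M]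
    [Module R M] [Fintype n] [DecidableEq n] (b : Module.Basis n R M) {P Q : Matrix n n R}
    (hPQ : P * Q = 1) : ∃ b' : Module.Basis n R M, ∀ f : M →ₗ[R] M,
      LinearMap.toMatrix b' b' f = P * LinearMap.toMatrix b b f * Q := by
  let e : M ≃ₗ[R] M := Matrix.toLinOfInv b b (mul_eq_one_comm.1 hPQ) hPQ
  refine ⟨b.map e, fun f => ?_⟩
  have hconj : LinearMap.toMatrix (b.map e) (b.map e) f =
      LinearMap.toMatrix b b (Matrix.toLin b b P ∘ₗ f ∘ₗ Matrix.toLin b b Q) := rfl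
  rw [hconj, LinearMap.toMatrix_comp b b b, LinearMap.toMatrix_comp b b b,
    LinearMap.toMatrix_toLin, LinearMap.toMatrix_toLin, Matrix.mul_assoc]

theorem pairing_mul_inv_smul_pairing (N : ℕ) :
    (Matrix.of pairing : Matrix (Cube N) (Cube N) ℂ) * ((2 : ℂ) ^ N)⁻¹ • Matrix.of pairing = 1 := by
  ext i k
  rw [Matrix.mul_smul, Matrix.smul_apply, Matrix.mul_apply, Matrix.one_apply]
  refine (congrArg _ (sum_pairing_mul i k)).trans ?_
  rw [smul_ite, smul_zero, smul_eq_mul, inv_mul_cancel₀ (pow_ne_zero _ two_ne_zero)]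

theorem corresponds_fullAntisymRep (N : ℕ) :
    Corresponds (theta N) (fullAntisymRep N) (magic N) := by
  obtain ⟨b, hb⟩ := exists_basis_toMatrix_eq_mul_mul (cubeBasis N) (pairing_mul_inv_smul_pairing N)
  refine ⟨b, (magic N).map (theta N).symm, fun g i k => ?_, ?_⟩
  · rw [hb, Matrix.map_apply, magic_eq_sum_cubeMat, ← evalHom_apply, map_smul, map_smul,
      Matrix.mul_smul, Matrix.smul_apply]
    congr 1
    rw [Matrix.mul_assoc, Matrix.mul_apply, map_sum, map_sum]
    refine Finset.sum_congr rfl fun j _ => ?_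
    rw [Matrix.mul_apply, Finset.mul_sum, map_sum, map_sum]
    refine Finset.sum_congr rfl fun l _ => ?_
    rw [toMatrix_cubeBasis, map_smul, map_smul, evalHom_apply, smul_eq_mul, Matrix.of_apply,
      Matrix.of_apply]
    ring
  · ext1 i k
    rw [Matrix.map_apply, Matrix.map_apply, LinearEquiv.apply_symm_apply]

/-! ### Characters -/

section Characters

variable {r : ℕ}

/-- The permutation of `Fin N` given by a permutation of the elements of `A`, listed in increasing
order. -/
def extendPerm (A : CardSubset N r) (τ : Equiv.Perm (Fin r)) : Equiv.Perm (Fin N) :=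
  τ.extendDomain (A.1.orderIsoOfFin A.2).toEquiv

theorem extendPerm_enum (A : CardSubset N r) (τ : Equiv.Perm (Fin r)) (t : Fin r) :
    extendPerm A τ (A.enum t) = A.enum (τ t) :=
  Equiv.Perm.extendDomain_apply_image τ (A.1.orderIsoOfFin A.2).toEquiv t

theorem extendPerm_of_notMem {A : CardSubset N r} (τ : Equiv.Perm (Fin r)) {a : Fin N}
    (ha : a ∉ A.1) : extendPerm A τ a = a :=
  Equiv.Perm.extendDomain_apply_not_subtype τ _ ha

theorem sign_extendPerm (A : CardSubset N r) (τ : Equiv.Perm (Fin r)) :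
    Equiv.Perm.sign (extendPerm A τ) = Equiv.Perm.sign τ :=
  Equiv.Perm.sign_extendDomain _ _

theorem extendPerm_injective (A : CardSubset N r) : Function.Injective (extendPerm A) :=
  Equiv.Perm.extendDomainHom_injective (A.1.orderIsoOfFin A.2).toEquiv

theorem image_eq_of_mem_permsOn {A : Finset (Fin N)} {σ : Equiv.Perm (Fin N)}
    (hσ : σ ∈ permsOn A) : A.image σ = A := by
  refine Finset.eq_of_subset_of_card_le (Finset.image_subset_iff.2 fun a ha => ?_)
    (Finset.card_image_of_injective A σ.injective).ge
  by_contra hσa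
  have hfix : σ a = a := σ.injective ((Finset.mem_filter.1 hσ).2 _ hσa)
  exact hσa (by rwa [hfix])

theorem exists_extendPerm {A : CardSubset N r} {σ : Equiv.Perm (Fin N)} (hσ : σ ∈ permsOn A.1) :
    ∃ τ, extendPerm A τ = σ := by
  have hinj : Function.Injective fun t => σ (A.enum t) := σ.injective.comp A.enum.injective
  have himage : Finset.univ.image (fun t => σ (A.enum t)) = A.1 := by
    conv_rhs => rw [← image_eq_of_mem_permsOn hσ, ← A.image_enum, Finset.image_image]
    rfl
  obtain ⟨τ, hτ⟩ := A.exists_perm_of_parity_eq hinj ((parity_ofFn_of_injective hinj).trans himage)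
  refine ⟨τ, Equiv.ext fun a => ?_⟩
  by_cases ha : a ∈ A.1
  · obtain ⟨t, rfl⟩ : a ∈ Set.range A.enum := by rwa [A.range_enum]
    exact (extendPerm_enum A τ t).trans (congrFun hτ t)
  · rw [extendPerm_of_notMem τ ha, (Finset.mem_filter.1 hσ).2 a ha]

theorem sum_permsOn (A : CardSubset N r) {M : Type*} [AddCommMonoid M]
    (f : Equiv.Perm (Fin N) → M) :
    ∑ σ ∈ permsOn A.1, f σ = ∑ τ : Equiv.Perm (Fin r), f (extendPerm A τ) := by
  have himage : permsOn A.1 = Finset.univ.image (extendPerm A) := by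
    ext σ
    refine ⟨fun hσ => ?_, fun hσ => ?_⟩
    · simpa using exists_extendPerm hσ
    · obtain ⟨τ, -, rfl⟩ := Finset.mem_image.1 hσ
      exact Finset.mem_filter.2 ⟨Finset.mem_univ _, fun a => extendPerm_of_notMem τ⟩
  rw [himage, Finset.sum_image fun _ _ _ _ h => extendPerm_injective A h]

theorem orderedProd_extendPerm (A : CardSubset N r) (τ : Equiv.Perm (Fin r)) :
    orderedProd A.1 (extendPerm A τ) =
      wordProd (ubar N) (word A.enum fun t => A.enum (τ t)) := by
  rw [orderedProd, ← Finset.listMap_orderEmbOfFin_finRange A.1 A.2, List.map_map, wordProd_word,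
    List.ofFn_eq_map]
  congr 1
  exact List.map_congr_left fun t _ => congrArg _ (extendPerm_enum A τ t)

theorem prod_extendPerm (A : CardSubset N r) (τ : Equiv.Perm (Fin r)) :
    ∏ a ∈ A.1, uO N a (extendPerm A τ a) =
      wordProd (uO N) (word A.enum fun t => A.enum (τ t)) := by
  rw [wordProd_word_eq_prod]
  conv_lhs => rw [← A.image_enum, Finset.prod_image fun _ _ _ _ h => A.enum.injective h]
  exact Finset.prod_congr rfl fun t _ => congrArg _ (extendPerm_enum A τ t)

theorem theta_sign_smul_prod {A : Finset (Fin N)} {σ : Equiv.Perm (Fin N)} (hσ : σ ∈ permsOn A) :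
    theta N (((Equiv.Perm.sign σ : ℤ) : ℂ) • ∏ a ∈ A, uO N a (σ a)) = orderedProd A σ := by
  obtain ⟨τ, rfl⟩ := exists_extendPerm (A := ⟨A, rfl⟩) hσ
  have hsorted : listSign (List.ofFn (CardSubset.enum ⟨A, rfl⟩)) = 1 := by
    simpa using listSign_ofFn_comp_perm (CardSubset.enum ⟨A, rfl⟩) 1
  rw [prod_extendPerm ⟨A, rfl⟩, orderedProd_extendPerm ⟨A, rfl⟩, wordProd_ubar_eq_theta,
    wordSign_word, listSign_ofFn_comp_perm, sign_extendPerm, hsorted, one_mul]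

theorem minor_enum_self (A : CardSubset N r) : minor A.enum A.enum =
    ∑ σ ∈ permsOn A.1, ((Equiv.Perm.sign σ : ℤ) : ℂ) • ∏ a ∈ A.1, uO N a (σ a) := by
  rw [sum_permsOn, minor, ← Matrix.det_transpose, Matrix.det_apply']
  refine Finset.sum_congr rfl fun τ _ => ?_
  rw [prod_extendPerm, wordProd_word_eq_prod, sign_extendPerm, Algebra.smul_def, map_intCast]
  rfl

theorem coactCoeff_self (A : Finset (Fin N)) :
    coactCoeff A A = ∑ σ ∈ permsOn A, orderedProd A σ := by
  rw [coactCoeff_eq_theta_minor ⟨A, rfl⟩ ⟨A, rfl⟩, minor_enum_self, map_sum]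
  exact Finset.sum_congr rfl fun σ hσ => theta_sign_smul_prod hσ

theorem sum_cardSubset {M : Type*} [AddCommMonoid M] (f : Finset (Fin N) → M) :
    ∑ A : CardSubset N r, f A.1 = ∑ A ∈ Finset.univ.powersetCard r, f A :=
  (Finset.sum_subtype _ (fun A => by simp [Finset.mem_powersetCard]) f).symm

theorem trace_magicComponent (N r : ℕ) : (magicComponent N r).trace = chiBar N r := by
  rw [chiBar, Matrix.trace, ← sum_cardSubset]
  exact Finset.sum_congr rfl fun A _ => coactCoeff_self A.1

theorem theta_chiO (N r : ℕ) : theta N (chiO N r) = chiBar N r := by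
  simp only [chiO, chiBar, map_sum]
  exact Finset.sum_congr rfl fun A _ => Finset.sum_congr rfl fun σ hσ => theta_sign_smul_prod hσ

theorem trace_antisymRep (g : O N) :
    LinearMap.trace ℂ _ (antisymRep N r g) = evalO (chiO N r) g := by
  rw [LinearMap.trace_eq_matrix_trace ℂ (xiBasis N r), Matrix.trace, chiO, ← sum_cardSubset,
    ← evalHom_apply, map_sum]
  refine Finset.sum_congr rfl fun A _ => ?_
  rw [Matrix.diag_apply, toMatrix_antisymRep, ← evalHom_apply, minor_enum_self]

end Characters

theorem trace_magic_eq_trace_cubeMat (N : ℕ) : (magic N).trace = (cubeMat N).trace := by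
  have hdiag : ∀ j, ∑ i, ∑ l, (pairing i j * pairing l i) • cubeMat N j l =
      (2 : ℂ) ^ N • cubeMat N j j := fun j => by
    rw [Finset.sum_comm]
    simp only [← Finset.sum_smul, mul_comm (pairing _ j), sum_pairing_mul, ite_smul, zero_smul]
    rw [Finset.sum_ite_eq', if_pos (Finset.mem_univ _)]
  simp only [Matrix.trace, Matrix.diag_apply, magic_eq_sum_cubeMat]
  rw [← Finset.smul_sum, Finset.sum_comm]
  simp only [hdiag]
  rw [← Finset.smul_sum, smul_smul, inv_mul_cancel₀ (pow_ne_zero _ two_ne_zero), one_smul]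

theorem trace_magic (N : ℕ) : (magic N).trace = ∑ r ∈ Finset.range (N + 1), chiBar N r := by
  have hsubsets : (cubeMat N).trace = ∑ A : Finset (Fin N), coactCoeff A A :=
    ((cubeEquiv N).sum_comp fun j => cubeMat N j j).symm
  rw [trace_magic_eq_trace_cubeMat, hsubsets, ← Finset.powerset_univ, Finset.sum_powerset,
    Finset.card_univ, Fintype.card_fin]
  simp only [chiBar, coactCoeff_self]

end

end TwistedOrth

theorem theorem4p3 (N : ℕ) :
    ∃ (Δ : PolObar N →ₐ[ℂ] PolObar N ⊗[ℂ] PolObar N) (ε : PolObar N →ₐ[ℂ] ℂ)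
      (θ : PolO N ≃ₗ[ℂ] PolObar N),
      -- the quantum group structure of `Ō_N`
      IsComul Δ ∧ IsCounit ε ∧
      -- the twisting correspondence between the representations of `O_N` and of `Ō_N`
      IsTwist θ ∧ (∀ θ' : PolO N ≃ₗ[ℂ] PolObar N, IsTwist θ' → θ' = θ) ∧
      (∀ (n : ℕ) (ρ : Matrix (Fin n) (Fin n) (PolO N)), IsRep ρ ↔ IsCorep Δ ε (ρ.map θ)) ∧
      (∀ (n m : ℕ) (ρ : Matrix (Fin n) (Fin n) (PolO N)) (τ : Matrix (Fin m) (Fin m) (PolO N)),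
        IsRep ρ → IsRep τ → CorepEquiv ((ρ ⊗ₖ τ).map θ) (ρ.map θ ⊗ₖ τ.map θ)) ∧
      -- the magic representation corresponds to the full antisymmetric representation
      IsMagicUnitary (magic N) ∧ IsCorep Δ ε (magic N) ∧
      Corresponds θ (fullAntisymRep N) (magic N) ∧
      -- the same, in each degree
      (∀ A B : Finset (Fin N), A.card ≠ B.card → coactCoeff A B = 0) ∧
      (∀ r ≤ N, IsCorep Δ ε (magicComponent N r) ∧
        Corresponds θ (antisymRep N r) (magicComponent N r)) ∧
      -- the same, for the characters
      (magic N).trace = ∑ r ∈ Finset.range (N + 1), chiBar N r ∧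
      (∀ r ≤ N, (magicComponent N r).trace = chiBar N r ∧
        (∀ g : O N, LinearMap.trace ℂ _ (antisymRep N r g) = evalO (chiO N r) g) ∧
        θ (chiO N r) = chiBar N r) ∧
      (∀ (A : Finset (Fin N)), ∀ σ ∈ permsOn A,
        θ (((Equiv.Perm.sign σ : ℤ) : ℂ) • ∏ a ∈ A, uO N a (σ a)) = orderedProd A σ) := by
  obtain ⟨Δ, hΔ⟩ := exists_comul N
  obtain ⟨ε, hε⟩ := exists_counit N
  exact ⟨Δ, ε, theta N, hΔ, hε, isTwist_theta N, fun _ hθ' => hθ'.eq_theta,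
    fun _ ρ => isRep_iff_isCorep hΔ hε ρ,
    fun _ _ _ _ hρ hτ => corepEquiv_kronecker hρ hτ,
    isMagicUnitary_magic N,
    (corresponds_fullAntisymRep N).isCorep hΔ hε, corresponds_fullAntisymRep N,
    fun _ _ hAB => coactCoeff_eq_zero hAB,
    fun r _ => ⟨(corresponds_antisymRep N r).isCorep hΔ hε, corresponds_antisymRep N r⟩,
    trace_magic N,
    fun r _ => ⟨trace_magicComponent N r, trace_antisymRep, theta_chiO N r⟩,
    fun _ _ hσ => theta_sign_smul_prod hσ⟩
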